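/- For integers $b\ge 0$ put $[b]=\{1,\dots,b\}$. A matching is a collection of pairwise disjoint sets; for a family $\mathcal F\subseteq 2^{[n]}$ let $\nu(\mathcal F)$ be the maximum size of a matching contained in $\mathcal F$, and let $e(n,s)=\max\{|\mathcal F|:\mathcal F\subseteq 2^{[n]},\ \nu(\mathcal F)<s\}$. A family $\mathcal F\subseteq 2^{[n]}$ is called shifted if, whenever $\{a_1<\dots<a_k\}\in\mathcal F$ and $\{b_1<\dots<b_k\}\subseteq[n]$ satisfies $b_i\le a_i$ for all $i$, also $\{b_1,\dots,b_k\}\in\mathcal F$. For $n=ms+c$ with $1\le c\le s$ and $\ell=s-c$, put \[ \mathcal Q(m,s,\ell)=\{P\subseteq[n]:|P|+|P\cap[ms-c-1]|\ge 2m\},\qquad \mathcal W(m,s,\ell)=\{P\subseteq[n]:|P\cap[ms-1]|\ge m\}. \] **Theorem.** For all integers $m\ge 1$ and $c\ge 1$ there exists $s_0>c$ such that for every $s\ge s_0$, with $n=ms+c$ and $\ell=s-c$, \[ e(n,s)=|\mathcal Q(m,s,\ell)|. \] Moreover, if $c\ge 2$, then $\mathcal Q(m,s,\ell)$ is the unique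 shifted family $\mathcal F\subseteq 2^{[n]}$ with $\nu(\mathcal F)<s$ and $|\mathcal F|=e(n,s)$; if $c=1$, then the shifted families $\mathcal F\subseteq 2^{[n]}$ with $\nu(\mathcal F)<s$ and $|\mathcal F|=e(n,s)$ are exactly $\mathcal Q(m,s,\ell)$ and $\mathcal W(m,s,\ell)$. -/

import Mathlib

namespace MatchingFree

/-- The power set `2^[n]` of `[n] = {1, …, n}`. -/
def cube (n : ℕ) : Finset (Finset ℕ) := (Finset.Icc 1 n).powerset

/-- A matching is a collection of pairwise disjoint sets. -/
def IsMatching (M : Finset (Finset ℕ)) : Prop :=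
  ∀ A ∈ M, ∀ B ∈ M, A ≠ B → Disjoint A B

instance (M : Finset (Finset ℕ)) : Decidable (IsMatching M) := by
  unfold IsMatching; infer_instance

/-- `ν(F)`: the maximum size of a matching contained in the family `F`. -/
def matchingNumber (F : Finset (Finset ℕ)) : ℕ :=
  (F.powerset.filter fun M => IsMatching M).sup Finset.card

/-- `e(n, s)`: the maximum size of a family `F ⊆ 2^[n]` with `ν(F) < s`. -/
def e (n s : ℕ) : ℕ :=
  ((cube n).powerset.filter fun F => matchingNumber F < s).sup Finset.card

/-- The set `A = (a₁ < … < a_k)` can be shifted to `B = (b₁ < … < b_k)`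
if `b_i ≤ a_i` for all `i`. -/
def CanShift (A B : Finset ℕ) : Prop :=
  ∃ (k : ℕ) (hA : A.card = k) (hB : B.card = k),
    ∀ i : Fin k, B.orderEmbOfFin hB i ≤ A.orderEmbOfFin hA i

/-- A family `F` of subsets of `[n]` is shifted if with every `A ∈ F` it contains every
`B ⊆ [n]` to which `A` can be shifted. -/
def IsShifted (n : ℕ) (F : Finset (Finset ℕ)) : Prop :=
  ∀ A ∈ F, ∀ B ∈ cube n, CanShift A B → B ∈ F

/-- `Q(m, s, ℓ) = {P ⊆ [n] : |P| + |P ∩ [ms - c - 1]| ≥ 2m}`,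
where `c = s - ℓ` and `n = ms + c`. -/
def Q (m s ℓ : ℕ) : Finset (Finset ℕ) :=
  (cube (m * s + (s - ℓ))).filter fun P =>
    2 * m ≤ P.card + (P ∩ Finset.Icc 1 (m * s - (s - ℓ) - 1)).card

/-- `W(m, s, ℓ) = {P ⊆ [n] : |P ∩ [ms - 1]| ≥ m}`, where `c = s - ℓ` and `n = ms + c`. -/
def W (m s ℓ : ℕ) : Finset (Finset ℕ) :=
  (cube (m * s + (s - ℓ))).filter fun P =>
    m ≤ (P ∩ Finset.Icc 1 (m * s - 1)).card

/-- `F ⊆ 2^[n]` is a shifted family attaining the maximum in the definition of `e(n, s)`. -/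
def IsShiftedExtremal (n s : ℕ) (F : Finset (Finset ℕ)) : Prop :=
  F ⊆ cube n ∧ matchingNumber F < s ∧ F.card = e n s ∧ IsShifted n F

end MatchingFree

/-! Neither extremal family has `s` disjoint members, by summing its defining inequality over them.
For the upper bound let `F` be compressed, without the empty set, and at least as large as `Q`. Its
up-closure is closed under dominance of initial counts, still packs no `s` disjoint members, and
misses at most `defect` sets, about `(2c+2) * n.choose (m-1)`.

Fix a constant `T` and look at the window `(n-T, n]`. Call a set `S` in the window good if every
`(m-1)`-subset of a bounded initial segment completes it to a member. By dominance a bad `S` costs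
about `n.choose (m-1)` missing sets, so at most `2c+2` sets are bad (`card_le_of_not_good`).
Likewise every `m`-set below the window with at most one point among the top `s-1-T` points there is
a member (`mem_of_card_inter_le_one`). Hence good sets extend to large packings
(`NearExtremal.packs`): each good set used saves one point below the window. In particular `T-c`
disjoint good sets cannot exist.

What remains is a finite count. The empty set is bad, and so are the singletons above the last good
one `u`. Put `t = n-u`; then `c < t ≤ 2c+1`. If `t = 2c+1`, all other subsets of the window are good
and every member satisfies the inequality of `Q`. Otherwise nested pairs above `u` would complete a
packing of `T-c` good sets, so one of them is bad; the bad pairs this forces exceed the budget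
unless `c = 1`, `t = 2`, which gives `W`.

For `c = 1` a symmetric difference shows that `Q` and `W` have equal size. A family containing the
empty set is strictly smaller, by exchanging the empty set for two missing sets that intersect. -/

namespace MatchingFree

/-! ### Packings -/

/-- `Packs 𝒜 r Y`: there are `r` pairwise disjoint members of `𝒜` inside `Y`
(the empty set may be used repeatedly). -/
def Packs (𝒜 : Finset ℕ → Prop) : ℕ → Finset ℕ → Prop
  | 0, _ => True
  | r + 1, Y => ∃ A ⊆ Y, 𝒜 A ∧ Packs 𝒜 r (Y \ A)

theorem Packs.mono {𝒜 : Finset ℕ → Prop} {r : ℕ} {Y Z : Finset ℕ} (h : Packs 𝒜 r Y)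
    (hYZ : Y ⊆ Z) : Packs 𝒜 r Z := by
  induction r generalizing Y Z with
  | zero => trivial
  | succ r ih =>
    obtain ⟨A, hA, hm, hr⟩ := h
    exact ⟨A, hA.trans hYZ, hm, ih hr (Finset.sdiff_subset_sdiff hYZ subset_rfl)⟩

theorem Packs.of_exists_subset {𝒜 ℬ : Finset ℕ → Prop} (h : ∀ R, 𝒜 R → ∃ P ⊆ R, ℬ P)
    {r : ℕ} {Y : Finset ℕ} (hp : Packs 𝒜 r Y) : Packs ℬ r Y := by
  induction r generalizing Y with
  | zero => trivial
  | succ r ih =>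
    obtain ⟨A, hA, hm, hr⟩ := hp
    obtain ⟨P, hP, hb⟩ := h A hm
    exact ⟨P, hP.trans hA, hb, (ih hr).mono (Finset.sdiff_subset_sdiff subset_rfl hP)⟩

theorem Packs.union {𝒜 : Finset ℕ → Prop} {a b : ℕ} {Y Z : Finset ℕ} (hY : Packs 𝒜 a Y)
    (hZ : Packs 𝒜 b Z) (hd : Disjoint Y Z) : Packs 𝒜 (a + b) (Y ∪ Z) := by
  induction a generalizing Y with
  | zero => simpa using hZ.mono Finset.subset_union_right
  | succ a ih =>
    obtain ⟨A, hA, hm, hr⟩ := hY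
    rw [Nat.add_right_comm]
    refine ⟨A, hA.trans Finset.subset_union_left, hm, ?_⟩
    have h := ih hr (hd.mono_left Finset.sdiff_subset)
    rw [Finset.union_sdiff_distrib, Finset.sdiff_eq_self_of_disjoint (hd.symm.mono_right hA)]
    exact h

theorem Packs.insert {𝒜 : Finset ℕ → Prop} {r : ℕ} {P Y : Finset ℕ} (hP : 𝒜 P) (hPY : P ⊆ Y)
    (h : Packs 𝒜 r (Y \ P)) : Packs 𝒜 (r + 1) Y := ⟨P, hPY, hP, h⟩

theorem packs_of_indexed {𝒜 : Finset ℕ → Prop} {q : ℕ} {Y : Finset ℕ} (f : ℕ → Finset ℕ)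
    (hf : ∀ i < q, 𝒜 (f i)) (hY : ∀ i < q, f i ⊆ Y)
    (hd : ∀ i < q, ∀ j < q, i ≠ j → Disjoint (f i) (f j)) : Packs 𝒜 q Y := by
  induction q generalizing Y with
  | zero => trivial
  | succ q ih =>
    refine ⟨f q, hY q (by omega), hf q (by omega), ih (fun i hi => hf i (by omega)) ?_
      (fun i hi j hj => hd i (by omega) j (by omega))⟩
    intro i hi
    exact Finset.subset_sdiff.2 ⟨hY i (by omega), hd i (by omega) q (by omega) (by omega)⟩

/-- If `𝒜` contains all `a`-subsets of `R` meeting `H` at most once and `R` is large enough,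
then `R` can be cut greedily. -/
theorem packs_greedy {𝒜 : Finset ℕ → Prop} {a q : ℕ} {R H : Finset ℕ} (ha : 1 ≤ a ∨ H = ∅)
    (h : ∀ X ⊆ R, X.card = a → (X ∩ H).card ≤ 1 → 𝒜 X) (hH : (R ∩ H).card ≤ q)
    (hR : a * q ≤ R.card) : Packs 𝒜 q R := by
  induction q generalizing R with
  | zero => trivial
  | succ q ih =>
    have hsplit := Finset.card_sdiff_add_card_inter R H
    suffices hs : ∃ X ⊆ R, X.card = a ∧ (X ∩ H).card ≤ 1 ∧ ((R \ X) ∩ H).card ≤ q by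
      obtain ⟨X, hX, hc, h1, h2⟩ := hs
      refine ⟨X, hX, h X hX hc h1, ih (fun Z hZ => h Z (hZ.trans Finset.sdiff_subset)) h2 ?_⟩
      rw [Finset.card_sdiff_of_subset hX, hc]
      rw [Nat.mul_succ] at hR
      omega
    -- While points of `H` remain, each piece takes exactly one, so `H` is exhausted within the
    -- allotted pieces.
    rcases (R ∩ H).eq_empty_or_nonempty with he | ⟨x, hx⟩
    · obtain ⟨X, hX, hc⟩ := Finset.exists_subset_card_eq (s := R) (n := a)
        (le_trans (Nat.le_mul_of_pos_right a q.succ_pos) hR)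
      have h0 : X ∩ H = ∅ := Finset.subset_empty.1 (he ▸ Finset.inter_subset_inter_right hX)
      have h1 : (R \ X) ∩ H = ∅ :=
        Finset.subset_empty.1 (he ▸ Finset.inter_subset_inter_right Finset.sdiff_subset)
      exact ⟨X, hX, hc, by simp [h0], by simp [h1]⟩
    · have ha : 1 ≤ a := by
        rcases ha with ha | ha
        · exact ha
        · simp [ha] at hx
      have hle : a - 1 ≤ (R \ H).card := by
        obtain ⟨b, rfl⟩ : ∃ b, a = b + 1 := ⟨a - 1, by omega⟩
        have : b ≤ b * (q + 1) := Nat.le_mul_of_pos_right b q.succ_pos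
        rw [Nat.add_mul] at hR
        omega
      obtain ⟨Z, hZ, hc⟩ := Finset.exists_subset_card_eq hle
      have hxR := Finset.mem_inter.1 hx
      have hxZ : x ∉ Z := fun hh => (Finset.mem_sdiff.1 (hZ hh)).2 hxR.2
      have hZH : Z ∩ H = ∅ := Finset.disjoint_iff_inter_eq_empty.1
        (Finset.disjoint_of_subset_left hZ Finset.sdiff_disjoint)
      refine ⟨Insert.insert x Z, ?_, ?_, ?_, ?_⟩
      · exact Finset.insert_subset hxR.1 (hZ.trans Finset.sdiff_subset)
      · rw [Finset.card_insert_of_notMem hxZ, hc]; omega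
      · rw [Finset.insert_inter_of_mem hxR.2, hZH]; simp
      · have : (R \ Insert.insert x Z) ∩ H ⊆ (R ∩ H).erase x := by
          intro y; simp; tauto
        have := Finset.card_le_card this
        rw [Finset.card_erase_of_mem hx] at this
        omega

theorem packs_of_card {𝒜 : Finset ℕ → Prop} {a q : ℕ} {R : Finset ℕ}
    (h : ∀ X ⊆ R, X.card = a → 𝒜 X) (hR : a * q ≤ R.card) : Packs 𝒜 q R :=
  packs_greedy (H := ∅) (Or.inr rfl) (fun X hX hc _ => h X hX hc) (by simp) hR

/-- Nonempty disjoint pieces are distinct, so they form a set of the right cardinality; repeated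
empty pieces would collapse. -/
theorem Packs.exists_matching {𝒜 : Finset ℕ → Prop} (h0 : ¬ 𝒜 ∅) {r : ℕ} {Y : Finset ℕ}
    (h : Packs 𝒜 r Y) :
    ∃ M : Finset (Finset ℕ), (∀ A ∈ M, 𝒜 A ∧ A ⊆ Y) ∧ IsMatching M ∧ M.card = r := by
  induction r generalizing Y with
  | zero => exact ⟨∅, by simp, by simp [IsMatching], rfl⟩
  | succ r ih =>
    obtain ⟨A, hA, hm, hr⟩ := h
    obtain ⟨M, h1, h2, h3⟩ := ih hr
    have hdis : ∀ B ∈ M, Disjoint B A := fun B hB =>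
      Finset.disjoint_of_subset_left (h1 B hB).2 Finset.sdiff_disjoint
    have hAM : A ∉ M := by
      intro hAM
      have := hdis A hAM
      rw [disjoint_self] at this
      exact h0 (by simpa [this] using hm)
    refine ⟨Insert.insert A M, ?_, ?_, by rw [Finset.card_insert_of_notMem hAM, h3]⟩
    · intro B hB
      rcases Finset.mem_insert.1 hB with rfl | hB
      · exact ⟨hm, hA⟩
      · exact ⟨(h1 B hB).1, (h1 B hB).2.trans Finset.sdiff_subset⟩
    · intro B hB C hC hne
      rcases Finset.mem_insert.1 hB with hB | hB <;> rcases Finset.mem_insert.1 hC with hC | hC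
      · exact absurd (hB.trans hC.symm) hne
      · exact hB ▸ (hdis C hC).symm
      · exact hC ▸ hdis B hB
      · exact h2 B hB C hC hne

theorem matchingNumber_lt_iff {F : Finset (Finset ℕ)} {s : ℕ} (hs : 0 < s) :
    matchingNumber F < s ↔ ∀ M ⊆ F, IsMatching M → M.card < s := by
  rw [matchingNumber, Finset.sup_lt_iff (by simpa using hs)]
  simp

theorem not_packs_of_matchingNumber_lt {F : Finset (Finset ℕ)} {s : ℕ} (h0 : ∅ ∉ F)
    (h : matchingNumber F < s) (Y : Finset ℕ) : ¬ Packs (· ∈ F) s Y := by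
  intro hp
  obtain ⟨M, h1, h2, h3⟩ := hp.exists_matching h0
  have := (matchingNumber_lt_iff (by omega)).1 h M (fun A hA => (h1 A hA).1) h2
  omega

theorem IsMatching.sum_card_inter_le {M : Finset (Finset ℕ)} (hM : IsMatching M)
    (Y : Finset ℕ) : ∑ P ∈ M, (P ∩ Y).card ≤ Y.card := by
  rw [← Finset.card_biUnion]
  · exact Finset.card_le_card (Finset.biUnion_subset.2 fun P _ => Finset.inter_subset_right)
  · intro A hA B hB hne
    exact (hM A hA B hB hne).mono Finset.inter_subset_left Finset.inter_subset_left

theorem inter_Icc_of_mem_cube {n : ℕ} {P : Finset ℕ} (hP : P ∈ cube n) :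
    P ∩ Finset.Icc 1 n = P :=
  Finset.inter_eq_left.2 (Finset.mem_powerset.1 hP)

theorem mem_Q {m s c : ℕ} (hcs : c ≤ s) {P : Finset ℕ} :
    P ∈ Q m s (s - c) ↔ P ∈ cube (m * s + c) ∧
      2 * m ≤ P.card + (P ∩ Finset.Icc 1 (m * s - c - 1)).card := by
  rw [Q, Nat.sub_sub_self hcs, Finset.mem_filter]

theorem mem_W {m s c : ℕ} (hcs : c ≤ s) {P : Finset ℕ} :
    P ∈ W m s (s - c) ↔ P ∈ cube (m * s + c) ∧
      m ≤ (P ∩ Finset.Icc 1 (m * s - 1)).card := by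
  rw [W, Nat.sub_sub_self hcs, Finset.mem_filter]

/-- Over `s` disjoint sets the weights total at most `(ms+c) + (ms-c-1) = 2ms-1`, less than the
required `2ms`. -/
theorem matchingNumber_Q_lt {m s c : ℕ} (hm : 1 ≤ m) (hcs : c < s) :
    matchingNumber (Q m s (s - c)) < s := by
  have hms : s ≤ m * s := Nat.le_mul_of_pos_left s hm
  rw [matchingNumber_lt_iff (by omega)]
  intro M hM hMm
  by_contra! hle
  have h1 := hMm.sum_card_inter_le (Finset.Icc 1 (m * s + c))
  have h2 := hMm.sum_card_inter_le (Finset.Icc 1 (m * s - c - 1))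
  have h3 : M.card * (2 * m) ≤ ∑ P ∈ M, ((P ∩ Finset.Icc 1 (m * s + c)).card +
      (P ∩ Finset.Icc 1 (m * s - c - 1)).card) := by
    rw [← smul_eq_mul]
    refine Finset.card_nsmul_le_sum _ _ _ fun P hP => ?_
    have := (mem_Q hcs.le).1 (hM hP)
    rw [inter_Icc_of_mem_cube this.1]
    exact this.2
  rw [Finset.sum_add_distrib] at h3
  simp only [Nat.card_Icc] at h1 h2
  have h4 : s * (2 * m) ≤ M.card * (2 * m) := Nat.mul_le_mul_right _ hle
  have h5 : s * (2 * m) = 2 * (m * s) := by ring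
  omega

theorem matchingNumber_W_lt {m s c : ℕ} (hm : 1 ≤ m) (hcs : c < s) :
    matchingNumber (W m s (s - c)) < s := by
  have hms : s ≤ m * s := Nat.le_mul_of_pos_left s hm
  rw [matchingNumber_lt_iff (by omega)]
  intro M hM hMm
  by_contra! hle
  have h2 := hMm.sum_card_inter_le (Finset.Icc 1 (m * s - 1))
  have h3 : M.card * m ≤ ∑ P ∈ M, (P ∩ Finset.Icc 1 (m * s - 1)).card := by
    rw [← smul_eq_mul]
    exact Finset.card_nsmul_le_sum _ _ _ fun P hP => ((mem_W hcs.le).1 (hM hP)).2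
  simp only [Nat.card_Icc] at h2
  have h4 : s * m ≤ M.card * m := Nat.mul_le_mul_right _ hle
  rw [Nat.mul_comm s m] at h4
  omega

/-! ### Compression -/

/-- Interchange the roles of `i` and `j` in a set. -/
def swapSet (i j : ℕ) (P : Finset ℕ) : Finset ℕ := P.map (Equiv.swap i j).toEmbedding

theorem mem_swapSet {i j x : ℕ} {P : Finset ℕ} :
    x ∈ swapSet i j P ↔ Equiv.swap i j x ∈ P := by
  rw [swapSet, Finset.mem_map_equiv, Equiv.symm_swap]

theorem swapSet_swapSet (i j : ℕ) (P : Finset ℕ) : swapSet i j (swapSet i j P) = P := by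
  ext x; simp [mem_swapSet]

theorem swapSet_injective (i j : ℕ) : Function.Injective (swapSet i j) :=
  Function.LeftInverse.injective (swapSet_swapSet i j)

theorem swapSet_eq_self {i j : ℕ} {P : Finset ℕ} (hi : i ∉ P) (hj : j ∉ P) :
    swapSet i j P = P := by
  ext x
  rw [mem_swapSet, Equiv.swap_apply_def]
  split_ifs with h1 h2
  · subst h1; tauto
  · subst h2; tauto
  · rfl

theorem swapSet_eq_insert_erase {i j : ℕ} {P : Finset ℕ} (hi : i ∉ P) (hj : j ∈ P) :
    swapSet i j P = insert i (P.erase j) := by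
  have hij : i ≠ j := fun h => hi (h ▸ hj)
  ext x
  rw [mem_swapSet, Equiv.swap_apply_def, Finset.mem_insert, Finset.mem_erase]
  split_ifs with h1 h2
  · subst h1; tauto
  · subst h2; tauto
  · tauto

/-- `F` is closed under replacing an element by a smaller one. -/
def StepClosed (F : Finset (Finset ℕ)) : Prop :=
  ∀ P ∈ F, ∀ j ∈ P, ∀ i, 1 ≤ i → i < j → i ∉ P → insert i (P.erase j) ∈ F

/-- The `(i, j)`-compression of a single member of `F`. -/
def pushDown (F : Finset (Finset ℕ)) (i j : ℕ) (P : Finset ℕ) : Finset ℕ :=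
  if j ∈ P ∧ i ∉ P ∧ swapSet i j P ∉ F then swapSet i j P else P

theorem pushDown_injOn (F : Finset (Finset ℕ)) (i j : ℕ) :
    Set.InjOn (pushDown F i j) F := by
  intro P hP R hR h
  unfold pushDown at h
  split_ifs at h with h1 h2 h2
  · exact swapSet_injective i j h
  · exact absurd (h ▸ hR) h1.2.2
  · exact absurd (h ▸ hP) h2.2.2
  · exact h

/-- If a matching uses a moved set, that set is its only member containing `i`. Swapping `i` and `j`
throughout then lands in `F`: an unmoved member that contains `j` but not `i` stayed put only
because its swap was already in `F`. -/
theorem matchingNumber_image_pushDown_lt {F : Finset (Finset ℕ)} {s i j : ℕ} (hs : 0 < s)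
    (h : matchingNumber F < s) :
    matchingNumber (F.image (pushDown F i j)) < s := by
  rw [matchingNumber_lt_iff hs] at h ⊢
  intro M hM hMm
  by_cases hMF : M ⊆ F
  · exact h M hMF hMm
  obtain ⟨A, hAM, hAF⟩ := Finset.not_subset.1 hMF
  obtain ⟨P, hP, hPA⟩ := Finset.mem_image.1 (hM hAM)
  have hPm : j ∈ P ∧ i ∉ P ∧ swapSet i j P ∉ F := by
    by_contra hc
    rw [pushDown, if_neg hc] at hPA
    exact hAF (hPA ▸ hP)
  rw [pushDown, if_pos hPm] at hPA
  have hiA : i ∈ A := by rw [← hPA, mem_swapSet]; simpa using hPm.1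
  have hsA : swapSet i j A = P := by rw [← hPA, swapSet_swapSet]
  have hsub : M.image (swapSet i j) ⊆ F := by
    intro C hC
    obtain ⟨B, hB, rfl⟩ := Finset.mem_image.1 hC
    by_cases hBA : B = A
    · rw [hBA, hsA]; exact hP
    have hiB : i ∉ B := Finset.disjoint_left.1 (hMm A hAM B hB (Ne.symm hBA)) hiA
    obtain ⟨R, hR, hRB⟩ := Finset.mem_image.1 (hM hB)
    have hRm : ¬ (j ∈ R ∧ i ∉ R ∧ swapSet i j R ∉ F) := by
      intro hc
      rw [pushDown, if_pos hc] at hRB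
      apply hiB
      rw [← hRB, mem_swapSet]; simpa using hc.1
    rw [pushDown, if_neg hRm] at hRB
    subst hRB
    by_cases hjR : j ∈ R
    · by_contra hc
      exact hRm ⟨hjR, hiB, hc⟩
    · rw [swapSet_eq_self hiB hjR]; exact hR
  have hmat : IsMatching (M.image (swapSet i j)) := by
    intro C hC C' hC' hne
    obtain ⟨B, hB, rfl⟩ := Finset.mem_image.1 hC
    obtain ⟨B', hB', rfl⟩ := Finset.mem_image.1 hC'
    exact (Finset.disjoint_map _).2 (hMm B hB B' hB' fun hh => hne (by rw [hh]))
  have := h _ hsub hmat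
  rwa [Finset.card_image_of_injective _ (swapSet_injective i j)] at this

/-- Among the admissible families of this size, one with least total sum of elements works: a
failing step would give a compression that lowers the sum. -/
theorem exists_stepClosed {n s : ℕ} (hs : 0 < s) {F : Finset (Finset ℕ)} (hF : F ⊆ cube n)
    (h0 : ∅ ∉ F) (hν : matchingNumber F < s) :
    ∃ G ⊆ cube n, ∅ ∉ G ∧ matchingNumber G < s ∧ G.card = F.card ∧ StepClosed G := by
  classical
  let 𝒞 := (cube n).powerset.filter fun G => ∅ ∉ G ∧ matchingNumber G < s ∧ G.card = F.card
  have hne : 𝒞.Nonempty :=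
    ⟨F, Finset.mem_filter.2 ⟨Finset.mem_powerset.2 hF, h0, hν, rfl⟩⟩
  obtain ⟨G, hG, hmin⟩ := Finset.exists_min_image 𝒞 (fun G => ∑ P ∈ G, ∑ x ∈ P, x) hne
  obtain ⟨hGc, hG0, hGν, hGcard⟩ := Finset.mem_filter.1 hG
  rw [Finset.mem_powerset] at hGc
  refine ⟨G, hGc, hG0, hGν, hGcard, ?_⟩
  intro P hP j hj i hi1 hij hiP
  by_contra hnot
  rw [← swapSet_eq_insert_erase hiP hj] at hnot
  have hsum : ∀ R, j ∈ R → i ∉ R → ∑ x ∈ swapSet i j R, x < ∑ x ∈ R, x := by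
    intro R hjR hiR
    rw [swapSet_eq_insert_erase hiR hjR, Finset.sum_insert (by simp [hiR]),
      ← Finset.add_sum_erase R (fun x => x) hjR]
    simpa using hij
  have hmem : G.image (pushDown G i j) ∈ 𝒞 := by
    refine Finset.mem_filter.2 ⟨Finset.mem_powerset.2 ?_, ?_,
      matchingNumber_image_pushDown_lt hs hGν, ?_⟩
    · intro C hC
      obtain ⟨R, hR, rfl⟩ := Finset.mem_image.1 hC
      have hRn := Finset.mem_powerset.1 (hGc hR)
      unfold pushDown
      split_ifs with hc
      · rw [swapSet_eq_insert_erase hc.2.1 hc.1]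
        refine Finset.mem_powerset.2 (Finset.insert_subset ?_ ((Finset.erase_subset _ _).trans hRn))
        have := Finset.mem_Icc.1 (hRn hc.1)
        exact Finset.mem_Icc.2 ⟨hi1, by omega⟩
      · exact hGc hR
    · intro hC
      obtain ⟨R, hR, hR0⟩ := Finset.mem_image.1 hC
      unfold pushDown at hR0
      split_ifs at hR0 with hc
      · rw [swapSet, Finset.map_eq_empty] at hR0
        exact hG0 (hR0 ▸ hR)
      · exact hG0 (hR0 ▸ hR)
    · rw [Finset.card_image_of_injOn (pushDown_injOn G i j), hGcard]
  have hle := hmin _ hmem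
  rw [Finset.sum_image (pushDown_injOn G i j)] at hle
  refine absurd hle (not_le.2 (Finset.sum_lt_sum (fun R _ => ?_) ⟨P, hP, ?_⟩))
  · unfold pushDown
    split_ifs with hc
    · exact (hsum R hc.1 hc.2.1).le
    · exact le_rfl
  · rw [pushDown, if_pos ⟨hj, hiP, hnot⟩]
    exact hsum P hj hiP

/-! ### Dominance -/

/-- The number of elements of `P` that are at most `t`. -/
def cnt (P : Finset ℕ) (t : ℕ) : ℕ := (P.filter (· ≤ t)).card

theorem cnt_mono {P R : Finset ℕ} (h : P ⊆ R) (t : ℕ) : cnt P t ≤ cnt R t :=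
  Finset.card_le_card (Finset.filter_subset_filter _ h)

theorem cnt_le_card (P : Finset ℕ) (t : ℕ) : cnt P t ≤ P.card :=
  Finset.card_filter_le _ _

theorem cnt_eq_card {P : Finset ℕ} {t : ℕ} (h : ∀ x ∈ P, x ≤ t) : cnt P t = P.card := by
  rw [cnt, Finset.filter_true_of_mem h]

theorem cnt_eq_zero {P : Finset ℕ} {t : ℕ} (h : ∀ x ∈ P, t < x) : cnt P t = 0 := by
  rw [cnt, Finset.filter_false_of_mem fun x hx => not_le.2 (h x hx), Finset.card_empty]

theorem cnt_union {P R : Finset ℕ} (h : Disjoint P R) (t : ℕ) :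
    cnt (P ∪ R) t = cnt P t + cnt R t := by
  rw [cnt, Finset.filter_union, Finset.card_union_of_disjoint
    (Finset.disjoint_filter_filter h)]; rfl

theorem cnt_eq_card_inter {n : ℕ} {P : Finset ℕ} (hP : P ∈ cube n) (t : ℕ) :
    cnt P t = (P ∩ Finset.Icc 1 t).card := by
  rw [cnt]
  congr 1
  ext x
  simp only [Finset.mem_filter, Finset.mem_inter, Finset.mem_Icc, and_congr_right_iff]
  intro hx
  have := Finset.mem_Icc.1 (Finset.mem_powerset.1 hP hx)
  omega

theorem card_eq_cnt {n : ℕ} {P : Finset ℕ} (hP : P ∈ cube n) : P.card = cnt P n :=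
  (cnt_eq_card fun _ hx => (Finset.mem_Icc.1 (Finset.mem_powerset.1 hP hx)).2).symm

theorem cnt_eq_card_filter_fin {A : Finset ℕ} {k : ℕ} (hA : A.card = k) (t : ℕ) :
    cnt A t = (Finset.univ.filter fun i : Fin k => A.orderEmbOfFin hA i ≤ t).card := by
  conv_lhs => rw [cnt, ← Finset.map_orderEmbOfFin_univ A hA, Finset.filter_map, Finset.card_map]
  rfl

/-- If `b_i > a_i` for some `i`, the threshold `a_i` already counts `i` in `A` but not in `B`. -/
theorem canShift_iff {A B : Finset ℕ} :
    CanShift A B ↔ A.card = B.card ∧ ∀ t, cnt A t ≤ cnt B t := by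
  constructor
  · rintro ⟨k, hA, hB, h⟩
    refine ⟨hA.trans hB.symm, fun t => ?_⟩
    rw [cnt_eq_card_filter_fin hA, cnt_eq_card_filter_fin hB]
    refine Finset.card_le_card fun i hi => ?_
    simp only [Finset.mem_filter, Finset.mem_univ, true_and] at hi ⊢
    exact (h i).trans hi
  · rintro ⟨hc, h⟩
    refine ⟨B.card, hc, rfl, fun i => ?_⟩
    by_contra! hlt
    have h1 := h (A.orderEmbOfFin hc i)
    rw [cnt_eq_card_filter_fin hc, cnt_eq_card_filter_fin rfl] at h1
    have h2 : (Finset.Iic i).card ≤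
        (Finset.univ.filter fun j => A.orderEmbOfFin hc j ≤ A.orderEmbOfFin hc i).card := by
      refine Finset.card_le_card fun j hj => ?_
      simpa using hj
    have h3 : (Finset.univ.filter fun j => B.orderEmbOfFin rfl j ≤ A.orderEmbOfFin hc i).card ≤
        (Finset.Iio i).card := by
      refine Finset.card_le_card fun j hj => ?_
      simp only [Finset.mem_filter, Finset.mem_univ, true_and] at hj
      exact Finset.mem_Iio.2 ((OrderEmbedding.lt_iff_lt _).1 (hj.trans_lt hlt))
    rw [Fin.card_Iic] at h2
    rw [Fin.card_Iio] at h3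
    omega

/-- `F` is closed under passing to sets with larger initial counts. -/
def DomClosed (n : ℕ) (F : Finset (Finset ℕ)) : Prop :=
  ∀ P ∈ F, ∀ R ∈ cube n, (∀ t, cnt P t ≤ cnt R t) → R ∈ F

theorem DomClosed.isShifted {n : ℕ} {F : Finset (Finset ℕ)} (h : DomClosed n F) :
    IsShifted n F := fun A hA B hB hAB => h A hA B hB (canShift_iff.1 hAB).2

theorem cnt_step {P : Finset ℕ} {i j : ℕ} (hj : j ∈ P) (hi : i ∉ P) {t : ℕ} (hij : i < j)
    (ht : j ≤ t) : cnt (insert i (P.erase j)) t = cnt P t := by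
  have h1 : (insert i (P.erase j)).filter (· ≤ t) = insert i ((P.filter (· ≤ t)).erase j) := by
    ext x
    simp only [Finset.mem_filter, Finset.mem_insert, Finset.mem_erase]
    constructor
    · tauto
    · rintro (rfl | h)
      · exact ⟨Or.inl rfl, by omega⟩
      · tauto
  rw [cnt, h1, Finset.card_insert_of_notMem (by simp [hi]),
    Finset.card_erase_add_one (by simp [hj, ht]), cnt]

theorem IsShifted.stepClosed {n : ℕ} {F : Finset (Finset ℕ)} (hF : F ⊆ cube n)
    (h : IsShifted n F) : StepClosed F := by
  intro P hP j hj i hi1 hij hiP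
  have hPn := Finset.mem_powerset.1 (hF hP)
  refine h P hP _ ?_ (canShift_iff.2 ⟨?_, fun t => ?_⟩)
  · refine Finset.mem_powerset.2 (Finset.insert_subset ?_ ((Finset.erase_subset _ _).trans hPn))
    have := Finset.mem_Icc.1 (hPn hj)
    exact Finset.mem_Icc.2 ⟨hi1, by omega⟩
  · rw [Finset.card_insert_of_notMem (by simp [hiP]), Finset.card_erase_add_one hj]
  · rcases lt_or_ge t j with ht | ht
    · refine Finset.card_le_card fun x hx => ?_
      simp only [Finset.mem_filter, Finset.mem_insert, Finset.mem_erase] at hx ⊢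
      exact ⟨Or.inr ⟨by omega, hx.1⟩, hx.2⟩
    · exact (cnt_step hj hiP hij ht).ge

/-- Let `j` be least in `P \ R`. Dominance at `j`, together with `j ∉ R`, yields some `i < j` in `R
\ P`. Replacing `j` by `i` keeps the dominance and shrinks `P \ R`. -/
theorem StepClosed.exists_subset {F : Finset (Finset ℕ)} (h : StepClosed F) {P R : Finset ℕ}
    (hP : P ∈ F) (hR : ∀ x ∈ R, 1 ≤ x) (hd : ∀ t, cnt P t ≤ cnt R t) : ∃ S ⊆ R, S ∈ F := by
  induction hk : (P \ R).card generalizing P with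
  | zero =>
    rw [Finset.card_eq_zero, Finset.sdiff_eq_empty_iff_subset] at hk
    exact ⟨P, hk, hP⟩
  | succ k ih =>
    have hne : (P \ R).Nonempty := Finset.card_pos.1 (by omega)
    obtain ⟨hjm, hjmin⟩ : (P \ R).min' hne ∈ P \ R ∧ ∀ x ∈ P \ R, (P \ R).min' hne ≤ x :=
      ⟨Finset.min'_mem _ _, fun x hx => Finset.min'_le _ _ hx⟩
    set j := (P \ R).min' hne
    obtain ⟨hjP, hjR⟩ := Finset.mem_sdiff.1 hjm
    have hlow : ∀ x ∈ P, x < j → x ∈ R := by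
      intro x hx hxj
      by_contra hxR
      have := hjmin x (Finset.mem_sdiff.2 ⟨hx, hxR⟩)
      omega
    obtain ⟨i, hiR, hij, hiP⟩ : ∃ i ∈ R, i < j ∧ i ∉ P := by
      by_contra! hcon
      have hlt : cnt R j < cnt P j := by
        refine Finset.card_lt_card ⟨fun x hx => ?_, fun hsub => ?_⟩
        · simp only [Finset.mem_filter] at hx ⊢
          refine ⟨hcon x hx.1 (lt_of_le_of_ne hx.2 ?_), hx.2⟩
          rintro rfl
          exact hjR hx.1
        · have := hsub (Finset.mem_filter.2 ⟨hjP, le_rfl⟩)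
          exact hjR (Finset.mem_filter.1 this).1
      exact absurd (hd j) (by omega)
    refine ih (h P hP j hjP i (hR i hiR) hij hiP) (fun t => ?_) ?_
    · rcases lt_or_ge t j with ht | ht
      · refine Finset.card_le_card fun x hx => ?_
        simp only [Finset.mem_filter, Finset.mem_insert, Finset.mem_erase] at hx ⊢
        refine ⟨?_, hx.2⟩
        rcases hx.1 with rfl | hx1
        · exact hiR
        · exact hlow x hx1.2 (by omega)
      · rw [cnt_step hjP hiP hij ht]; exact hd t
    · have : insert i (P.erase j) \ R = (P \ R).erase j := by
        ext x
        simp only [Finset.mem_sdiff, Finset.mem_insert, Finset.mem_erase]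
        constructor
        · rintro ⟨rfl | h1, h2⟩
          · exact absurd hiR h2
          · tauto
        · tauto
      rw [this, Finset.card_erase_of_mem hjm]
      omega

/-- The family of all sets in the cube that contain a member of `F`. -/
def upClosure (n : ℕ) (F : Finset (Finset ℕ)) : Finset (Finset ℕ) :=
  (cube n).filter fun R => ∃ P ∈ F, P ⊆ R

theorem subset_upClosure {n : ℕ} {F : Finset (Finset ℕ)} (hF : F ⊆ cube n) :
    F ⊆ upClosure n F := fun P hP => Finset.mem_filter.2 ⟨hF hP, P, hP, subset_rfl⟩

theorem StepClosed.domClosed_upClosure {n : ℕ} {F : Finset (Finset ℕ)} (h : StepClosed F) :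
    DomClosed n (upClosure n F) := by
  intro P hP R hR hd
  obtain ⟨-, S, hS, hSP⟩ := Finset.mem_filter.1 hP
  obtain ⟨S', hS', hF⟩ := h.exists_subset hS
    (fun x hx => (Finset.mem_Icc.1 (Finset.mem_powerset.1 hR hx)).1)
    (fun t => (cnt_mono hSP t).trans (hd t))
  exact Finset.mem_filter.2 ⟨hR, S', hF, hS'⟩

theorem not_packs_upClosure {n s : ℕ} {F : Finset (Finset ℕ)} (h0 : ∅ ∉ F)
    (h : matchingNumber F < s) (Y : Finset ℕ) : ¬ Packs (· ∈ upClosure n F) s Y := by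
  intro hp
  refine not_packs_of_matchingNumber_lt h0 h Y (hp.of_exists_subset fun R hR => ?_)
  obtain ⟨-, P, hP, hPR⟩ := Finset.mem_filter.1 hR
  exact ⟨P, hPR, hP⟩

theorem domClosed_Q {m s c : ℕ} (hcs : c ≤ s) : DomClosed (m * s + c) (Q m s (s - c)) := by
  intro P hP R hR hd
  rw [mem_Q hcs] at hP ⊢
  refine ⟨hR, ?_⟩
  rw [card_eq_cnt hR, ← cnt_eq_card_inter hR]
  rw [card_eq_cnt hP.1, ← cnt_eq_card_inter hP.1] at hP
  have h1 := hd (m * s + c)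
  have h2 := hd (m * s - c - 1)
  omega

theorem domClosed_W {m s c : ℕ} (hcs : c ≤ s) : DomClosed (m * s + c) (W m s (s - c)) := by
  intro P hP R hR hd
  rw [mem_W hcs] at hP ⊢
  refine ⟨hR, ?_⟩
  rw [← cnt_eq_card_inter hR]
  rw [← cnt_eq_card_inter hP.1] at hP
  exact hP.2.trans (hd _)

/-! ### Counting -/

/-- The number of subsets of an `N`-set with fewer than `d` elements. -/
def lowSum (d N : ℕ) : ℕ := ∑ a ∈ Finset.range d, N.choose a

theorem lowSum_mono (d : ℕ) {M N : ℕ} (h : M ≤ N) : lowSum d M ≤ lowSum d N :=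
  Finset.sum_le_sum fun a _ => Nat.choose_le_choose a h

/-- Pascal's rule `K` times, each increment being one lower binomial coefficient. -/
theorem choose_add_le (d M K : ℕ) :
    (M + K).choose d ≤ M.choose d + K * lowSum d (M + K) := by
  induction K with
  | zero => simp
  | succ K ih =>
    have hstep : (M + K + 1).choose d ≤ (M + K).choose d + lowSum d (M + K) := by
      cases d with
      | zero => simp
      | succ d =>
        have : (M + K).choose d ≤ lowSum (d + 1) (M + K) :=
          Finset.single_le_sum (f := fun a => (M + K).choose a) (fun _ _ => Nat.zero_le _)
            (Finset.self_mem_range_succ d)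
        rw [Nat.choose_succ_succ']
        omega
    have hm : lowSum d (M + K) ≤ lowSum d (M + (K + 1)) := lowSum_mono d (by omega)
    have hm' := Nat.mul_le_mul_left K hm
    rw [← Nat.add_assoc] at hm hm' ⊢
    rw [Nat.add_mul, one_mul]
    omega

theorem lowSum_le (d N : ℕ) (hN : 1 ≤ N) : lowSum d N ≤ d * N ^ (d - 1) := by
  have : lowSum d N ≤ ∑ _a ∈ Finset.range d, N ^ (d - 1) := by
    refine Finset.sum_le_sum fun a ha => ?_
    rw [Finset.mem_range] at ha
    exact (Nat.choose_le_pow N a).trans (Nat.pow_le_pow_right hN (by omega))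
  simpa using this

theorem pow_le_factorial_mul_choose (N d : ℕ) :
    (N + 1 - d) ^ d ≤ d.factorial * N.choose d := by
  rw [← Nat.descFactorial_eq_factorial_mul_choose]
  exact N.pow_sub_le_descFactorial d

/-- The left side has order `N^(d-1)`, the right side `N^d`; the threshold makes `N ≤ 2x` for `x =
N-K+1-d`, and `x` larger than the resulting constant. -/
theorem exists_forall_lowSum_lt_choose (d K C : ℕ) :
    ∃ N₀, ∀ N, N₀ ≤ N → C * lowSum d N < (N - K).choose d := by
  refine ⟨2 * (K + d) + C * d * d.factorial * 2 ^ (d - 1) + 2, fun N hN => ?_⟩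
  rcases Nat.eq_zero_or_pos d with rfl | hd
  · simp [lowSum]
  have h1 := pow_le_factorial_mul_choose (N - K) d
  have h2 := lowSum_le d N (by omega)
  set x := N - K + 1 - d with hx
  have hNx : N ≤ 2 * x := by omega
  have hxC : C * d * d.factorial * 2 ^ (d - 1) < x := by omega
  refine Nat.lt_of_mul_lt_mul_left (a := d.factorial) (lt_of_lt_of_le ?_ h1)
  calc d.factorial * (C * lowSum d N)
      ≤ d.factorial * (C * (d * (2 * x) ^ (d - 1))) := by
        gcongr
        exact h2.trans (by gcongr)
    _ = (C * d * d.factorial * 2 ^ (d - 1)) * x ^ (d - 1) := by rw [mul_pow]; ring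
    _ < x * x ^ (d - 1) := Nat.mul_lt_mul_of_pos_right hxC (pow_pos (by omega) _)
    _ = x ^ d := by rw [← pow_succ', Nat.sub_add_cancel hd]

theorem choose_le_pow_mul_choose {N q d b : ℕ} (h : N ≤ b * (q + 1 - d)) :
    N.choose d ≤ b ^ d * q.choose d := by
  refine Nat.le_of_mul_le_mul_left (c := d.factorial) ?_ d.factorial_pos
  calc d.factorial * N.choose d = N.descFactorial d :=
        (Nat.descFactorial_eq_factorial_mul_choose _ _).symm
    _ ≤ N ^ d := Nat.descFactorial_le_pow _ _
    _ ≤ (b * (q + 1 - d)) ^ d := by gcongr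
    _ = b ^ d * (q + 1 - d) ^ d := mul_pow _ _ _
    _ ≤ b ^ d * (d.factorial * q.choose d) := by
        gcongr; exact pow_le_factorial_mul_choose q d
    _ = _ := by ring

/-- The bound on the number of sets outside `Q`. -/
def defect (d c n : ℕ) : ℕ := (2 * c + 2) * n.choose d + 2 ^ (2 * c + 1) * lowSum d n

/-- Let `B` be the top `2c+1` points and `A` the rest. A set outside `Q` has weight at most `2m-1`,
so it has either `m-1` points in `A` and at most one in `B`, giving `2c+2` traces on `B`, or fewer
than `m-1` points in `A`. -/
theorem card_compl_Q_le {m s c : ℕ} (hm : 1 ≤ m) (hcs : c < s) :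
    (cube (m * s + c) \ Q m s (s - c)).card ≤ defect (m - 1) c (m * s + c) := by
  have hms : s ≤ m * s := Nat.le_mul_of_pos_left s hm
  set A := Finset.Icc 1 (m * s - c - 1) with hA
  set B := Finset.Ioc (m * s - c - 1) (m * s + c) with hB
  have hAc : A.card ≤ m * s + c := by rw [hA, Nat.card_Icc]; omega
  have hBc : B.card = 2 * c + 1 := by rw [hB, Nat.card_Ioc]; omega
  let X := A.powersetCard (m - 1) ×ˢ (B.powersetCard 0 ∪ B.powersetCard 1)
  let Y := ((Finset.range (m - 1)).biUnion fun a => A.powersetCard a) ×ˢ B.powerset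
  have hX : X.card ≤ (2 * c + 2) * (m * s + c).choose (m - 1) := by
    rw [Finset.card_product, Finset.card_powersetCard, mul_comm]
    refine Nat.mul_le_mul ((Finset.card_union_le _ _).trans ?_) (Nat.choose_le_choose _ hAc)
    rw [Finset.card_powersetCard, Finset.card_powersetCard, hBc]
    simp; omega
  have hY : Y.card ≤ 2 ^ (2 * c + 1) * lowSum (m - 1) (m * s + c) := by
    rw [Finset.card_product, Finset.card_powerset, hBc, mul_comm]
    refine Nat.mul_le_mul_left _ (Finset.card_biUnion_le.trans (Finset.sum_le_sum fun a _ => ?_))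
    rw [Finset.card_powersetCard]
    exact Nat.choose_le_choose _ hAc
  refine le_trans ?_ ((Finset.card_union_le X Y).trans (Nat.add_le_add hX hY))
  have hsplit : ∀ P ∈ cube (m * s + c), P = P ∩ A ∪ P ∩ B ∧ Disjoint (P ∩ A) (P ∩ B) := by
    intro P hP
    constructor
    · rw [← Finset.inter_union_distrib_left, eq_comm, Finset.inter_eq_left]
      intro x hx
      have := Finset.mem_Icc.1 (Finset.mem_powerset.1 hP hx)
      simp only [hA, hB, Finset.mem_union, Finset.mem_Icc, Finset.mem_Ioc]
      omega
    · refine Finset.disjoint_of_subset_left Finset.inter_subset_right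
        (Finset.disjoint_of_subset_right Finset.inter_subset_right ?_)
      rw [Finset.disjoint_left]
      intro x hx hx'
      rw [hA, Finset.mem_Icc] at hx
      rw [hB, Finset.mem_Ioc] at hx'
      omega
  refine Finset.card_le_card_of_injOn (fun P => (P ∩ A, P ∩ B)) ?_ ?_
  · intro P hP
    obtain ⟨hPc, hPQ⟩ := Finset.mem_sdiff.1 (Finset.mem_coe.1 hP)
    rw [mem_Q hcs.le, not_and, not_le] at hPQ
    have hw := hPQ hPc
    rw [← hA] at hw
    obtain ⟨h1, h2⟩ := hsplit P hPc
    have h3 : P.card = (P ∩ A).card + (P ∩ B).card := by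
      conv_lhs => rw [h1, Finset.card_union_of_disjoint h2]
    rw [Finset.mem_coe, Finset.mem_union, Finset.mem_product, Finset.mem_product]
    rcases Nat.lt_or_ge (P ∩ A).card (m - 1) with hlt | hge
    · right
      exact ⟨Finset.mem_biUnion.2 ⟨_, Finset.mem_range.2 hlt,
        Finset.mem_powersetCard.2 ⟨Finset.inter_subset_right, rfl⟩⟩,
        Finset.mem_powerset.2 Finset.inter_subset_right⟩
    · left
      refine ⟨Finset.mem_powersetCard.2 ⟨Finset.inter_subset_right, ?_⟩, ?_⟩
      · dsimp only; omega
      · rw [Finset.mem_union, Finset.mem_powersetCard, Finset.mem_powersetCard]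
        have : (P ∩ B).card = 0 ∨ (P ∩ B).card = 1 := by omega
        rcases this with h | h
        · exact Or.inl ⟨Finset.inter_subset_right, h⟩
        · exact Or.inr ⟨Finset.inter_subset_right, h⟩
  · intro P hP R hR h
    obtain ⟨h1, h2⟩ := Prod.mk.inj h
    rw [(hsplit P (Finset.mem_sdiff.1 (Finset.mem_coe.1 hP)).1).1,
      (hsplit R (Finset.mem_sdiff.1 (Finset.mem_coe.1 hR)).1).1, h1, h2]

/-- If all unions of a `d`-subset of `I` with a member of `ℬ` lie outside `F`, many sets do. -/
theorem card_mul_choose_le {ℬ 𝒢 : Finset (Finset ℕ)} {I : Finset ℕ} {d : ℕ}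
    (hI : ∀ S ∈ ℬ, Disjoint I S)
    (h : ∀ S ∈ ℬ, ∀ X ⊆ I, X.card = d → X ∪ S ∈ 𝒢) :
    ℬ.card * I.card.choose d ≤ 𝒢.card := by
  rw [← Finset.card_powersetCard, ← Finset.card_product]
  refine Finset.card_le_card_of_injOn (fun p => p.2 ∪ p.1) ?_ ?_
  · rintro ⟨S, X⟩ hp
    obtain ⟨h1, h2⟩ := Finset.mem_product.1 (Finset.mem_coe.1 hp)
    obtain ⟨h3, h4⟩ := Finset.mem_powersetCard.1 h2
    exact h S h1 X h3 h4
  · rintro ⟨S, X⟩ hp ⟨S', X'⟩ hp' heq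
    obtain ⟨h1, h2⟩ := Finset.mem_product.1 (Finset.mem_coe.1 hp)
    obtain ⟨h1', h2'⟩ := Finset.mem_product.1 (Finset.mem_coe.1 hp')
    have hX := (Finset.mem_powersetCard.1 h2).1
    have hX' := (Finset.mem_powersetCard.1 h2').1
    have hd := hI S h1
    have hd' := hI S' h1'
    dsimp only at heq hX hX' hd hd'
    rw [Finset.disjoint_left] at hd hd'
    rw [Finset.ext_iff] at heq
    simp only [Finset.mem_union] at heq
    ext x
    · have := heq x
      have := @hd x
      have := @hd' x
      have := @hX x
      have := @hX' x
      tauto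
    · have := heq x
      have := @hd x
      have := @hd' x
      have := @hX x
      have := @hX' x
      tauto

/-- Numerical conditions that hold for `s` large in terms of `m` and `c`. -/
structure Params (m c s T : ℕ) : Prop where
  two_mul_add_three_le : 2 * c + 3 ≤ T
  lt_left : m * T + 2 * m + T + c < s
  defect_lt : defect (m - 1) c (m * s + c) <
    (2 * c + 3) * (m * s + c - (T + (m * T + 2 * m))).choose (m - 1)
  defect_lt' : defect (m - 1) c (m * s + c) < T * (s - 1 - T).choose (m - 1)

/-- Both comparisons concern leading terms of degree `m-1`. The first rests on `2c+2 < 2c+3`; the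
second on `n.choose (m-1) ≤ (2m)^(m-1) * (s-1-T).choose (m-1)`, which dictates `T`. -/
theorem exists_params {m c : ℕ} (hm : 1 ≤ m) :
    ∃ T s₀, ∀ s, s₀ ≤ s → Params m c s T := by
  set d := m - 1 with hd
  set T := (2 * c + 3) * (2 * m) ^ d with hT
  set K := T + (m * T + 2 * m) with hK
  have hT3 : 2 * c + 3 ≤ T := Nat.le_mul_of_pos_right _ (pow_pos (by omega) _)
  obtain ⟨N₁, hN₁⟩ := exists_forall_lowSum_lt_choose d K ((2 * c + 2) * K + 2 ^ (2 * c + 1))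
  obtain ⟨N₂, hN₂⟩ := exists_forall_lowSum_lt_choose d 0 (2 ^ (2 * c + 1))
  refine ⟨T, N₁ + N₂ + K + 2 * T + 2 * d + 2 * c + 2, fun s hs => ?_⟩
  have hms : s ≤ m * s := Nat.le_mul_of_pos_left s hm
  refine ⟨hT3, by omega, ?_, ?_⟩
  · have h1 := hN₁ (m * s + c) (by omega)
    have h2 := choose_add_le d (m * s + c - K) K
    rw [Nat.sub_add_cancel (by omega)] at h2
    have h3 := Nat.mul_le_mul_left (2 * c + 2) h2
    rw [← hK]
    unfold defect
    nlinarith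
  · have h1 := hN₂ (m * s + c) (by omega)
    have h2 : (m * s + c).choose d ≤ (2 * m) ^ d * (s - 1 - T).choose d := by
      refine choose_le_pow_mul_choose ?_
      have h3 : 2 * (s - 1 - T + 1 - d) ≥ s + c := by omega
      have h4 := Nat.mul_le_mul_left m h3
      have h5 : c ≤ m * c := Nat.le_mul_of_pos_left c hm
      nlinarith
    have h3 := Nat.mul_le_mul_left (2 * c + 3) h2
    rw [Nat.sub_zero] at h1
    rw [hT, mul_assoc]
    unfold defect
    nlinarith

/-! ### The structure of nearly extremal families -/

/-- `S` is completed to a member of `F` by every `d`-subset of `[L]`. -/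
def Good (F : Finset (Finset ℕ)) (L d : ℕ) (S : Finset ℕ) : Prop :=
  ∀ X ⊆ Finset.Icc 1 L, X.card = d → X ∪ S ∈ F

theorem cnt_singleton (x t : ℕ) : cnt {x} t = if x ≤ t then 1 else 0 := by
  rw [cnt, Finset.filter_singleton]; split_ifs <;> rfl

theorem cnt_pair {x y : ℕ} (h : x ≠ y) (t : ℕ) :
    cnt {x, y} t = (if x ≤ t then 1 else 0) + if y ≤ t then 1 else 0 := by
  rw [Finset.insert_eq, cnt_union (by simpa using h), cnt_singleton, cnt_singleton]

theorem packs_good_union {F : Finset (Finset ℕ)} {L d k : ℕ} {Y R : Finset ℕ}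
    (h : Packs (Good F L d) k Y) (hd : Disjoint Y R) (hR : R ⊆ Finset.Icc 1 L)
    (hc : d * k ≤ R.card) : Packs (· ∈ F) k (Y ∪ R) := by
  induction k generalizing Y R with
  | zero => trivial
  | succ k ih =>
    obtain ⟨A, hA, hg, hr⟩ := h
    rw [Nat.mul_succ] at hc
    obtain ⟨X, hX, hXc⟩ := Finset.exists_subset_card_eq (s := R) (n := d) (by omega)
    refine ⟨X ∪ A, Finset.union_subset (hX.trans Finset.subset_union_right)
      (hA.trans Finset.subset_union_left), hg X (hX.trans hR) hXc, ?_⟩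
    refine (ih hr (R := R \ X) (hd.mono Finset.sdiff_subset Finset.sdiff_subset)
      (Finset.sdiff_subset.trans hR) ?_).mono ?_
    · rw [Finset.card_sdiff_of_subset hX]; omega
    · intro x hx
      rw [Finset.disjoint_left] at hd
      have h1 := @hd x
      have h2 := @hA x
      have h3 := @hX x
      simp only [Finset.mem_union, Finset.mem_sdiff] at hx ⊢
      tauto

/-- A dominance closed family without `s` disjoint members that misses few sets. -/
structure NearExtremal (m c s T n : ℕ) (F : Finset (Finset ℕ)) : Prop where
  one_le : 1 ≤ m
  one_le' : 1 ≤ c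
  params : Params m c s T
  eq : n = m * s + c
  subset : F ⊆ cube n
  dom : DomClosed n F
  not_packs : ¬ Packs (· ∈ F) s (Finset.Icc 1 n)
  card_le : (cube n \ F).card ≤ defect (m - 1) c n

theorem DomClosed.good_mono {n T L d : ℕ} {F : Finset (Finset ℕ)} (hF : DomClosed n F)
    (hL : L ≤ n - T) {S S' : Finset ℕ} (hS : S ⊆ Finset.Ioc (n - T) n)
    (hS' : S' ⊆ Finset.Ioc (n - T) n) (h : ∀ t, cnt S t ≤ cnt S' t) (hg : Good F L d S) :
    Good F L d S' := by
  intro X hX hc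
  have hdis : ∀ {A : Finset ℕ}, A ⊆ Finset.Ioc (n - T) n → Disjoint X A := by
    intro A hA
    rw [Finset.disjoint_left]
    intro x hx hxA
    have h1 := Finset.mem_Icc.1 (hX hx)
    have h2 := Finset.mem_Ioc.1 (hA hxA)
    omega
  refine hF _ (hg X hX hc) _ (Finset.mem_powerset.2 (Finset.union_subset ?_ ?_)) fun t => ?_
  · exact hX.trans (Finset.Icc_subset_Icc_right (by omega))
  · intro x hx
    have := Finset.mem_Ioc.1 (hS' hx)
    exact Finset.mem_Icc.2 ⟨by omega, by omega⟩
  · rw [cnt_union (hdis hS), cnt_union (hdis hS')]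
    exact Nat.add_le_add_left (h t) _

/-- Every `d`-subset of `[L]` dominates `X`, which lies beyond `L`; a single member `X ∪ S` would
make `S` good. -/
theorem DomClosed.notMem_of_not_good {n T L d : ℕ} {F : Finset (Finset ℕ)}
    (hF : DomClosed n F) (hL : L ≤ n - T) {S : Finset ℕ} (hS : S ⊆ Finset.Ioc (n - T) n)
    (hg : ¬ Good F L d S) {X : Finset ℕ} (hX : X ⊆ Finset.Ioc L (n - T)) (hc : X.card = d) :
    X ∪ S ∈ cube n \ F := by
  have hS1 : S ⊆ Finset.Icc 1 n := fun x hx => by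
    have := Finset.mem_Ioc.1 (hS hx)
    exact Finset.mem_Icc.2 ⟨by omega, by omega⟩
  rw [Finset.mem_sdiff]
  constructor
  · refine Finset.mem_powerset.2 (Finset.union_subset (fun x hx => ?_) hS1)
    have := Finset.mem_Ioc.1 (hX hx)
    exact Finset.mem_Icc.2 ⟨by omega, by omega⟩
  intro hmem
  refine hg fun Z hZ hZc => hF _ hmem _ (Finset.mem_powerset.2
    (Finset.union_subset (hZ.trans (Finset.Icc_subset_Icc_right (by omega))) hS1)) fun t => ?_
  have hdX : Disjoint X S := by
    rw [Finset.disjoint_left]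
    intro x hx hxA
    have h1 := Finset.mem_Ioc.1 (hX hx)
    have h2 := Finset.mem_Ioc.1 (hS hxA)
    omega
  have hdZ : Disjoint Z S := by
    rw [Finset.disjoint_left]
    intro x hx hxA
    have h1 := Finset.mem_Icc.1 (hZ hx)
    have h2 := Finset.mem_Ioc.1 (hS hxA)
    omega
  rw [cnt_union hdX, cnt_union hdZ]
  refine Nat.add_le_add_right ?_ _
  rcases le_or_gt t L with ht | ht
  · rw [cnt_eq_zero fun x hx => ?_]
    · exact Nat.zero_le _
    · have := Finset.mem_Ioc.1 (hX hx)
      omega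
  · rw [cnt_eq_card (P := Z) fun x hx => ?_, hZc, ← hc]
    · exact cnt_le_card _ _
    · have := Finset.mem_Icc.1 (hZ hx)
      omega

namespace NearExtremal

variable {m c s T n : ℕ} {F : Finset (Finset ℕ)}

theorem le_sub (h : NearExtremal m c s T n F) :
    m * T + 2 * m ≤ n - T ∧ s ≤ n ∧ T ≤ n := by
  have h1 := h.params.lt_left
  have h2 : s ≤ m * s := Nat.le_mul_of_pos_left s h.one_le
  have h3 := h.eq
  omega

theorem card_le_of_not_good (h : NearExtremal m c s T n F) {ℬ : Finset (Finset ℕ)}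
    (hℬ : ∀ S ∈ ℬ, S ⊆ Finset.Ioc (n - T) n ∧ ¬ Good F (m * T + 2 * m) (m - 1) S) :
    ℬ.card ≤ 2 * c + 2 := by
  by_contra! hlt
  have h1 := card_mul_choose_le (ℬ := ℬ) (𝒢 := cube n \ F)
    (I := Finset.Ioc (m * T + 2 * m) (n - T)) (d := m - 1) (fun S hS => ?_)
    (fun S hS X hX hXc => h.dom.notMem_of_not_good h.le_sub.1 (hℬ S hS).1 (hℬ S hS).2 hX hXc)
  · have h2 := h.params.defect_lt
    have h3 := h.card_le
    rw [Nat.card_Ioc, Nat.sub_sub] at h1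
    rw [← h.eq] at h2
    have h4 : (2 * c + 3) * (n - (T + (m * T + 2 * m))).choose (m - 1) ≤
        ℬ.card * (n - (T + (m * T + 2 * m))).choose (m - 1) := Nat.mul_le_mul_right _ hlt
    omega
  · rw [Finset.disjoint_left]
    intro x hx hxS
    have h1 := Finset.mem_Ioc.1 hx
    have h2 := Finset.mem_Ioc.1 ((hℬ S hS).1 hxS)
    omega

/-- If `X` were missing, so would be `Z ∪ {y}` for all `(m-1)`-subsets `Z` of the top `s-1-T` points
below the window and all `y` in it, since `X` dominates them. These are too many. -/
theorem mem_of_card_inter_le_one (h : NearExtremal m c s T n F) {X : Finset ℕ}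
    (hX : X ⊆ Finset.Icc 1 (n - T)) (hc : X.card = m)
    (h1 : (X ∩ Finset.Ioc (n - T - (s - 1 - T)) (n - T)).card ≤ 1) : X ∈ F := by
  by_contra hXF
  have hle := h.le_sub
  have hp := h.params.lt_left
  have key := card_mul_choose_le (ℬ := (Finset.Ioc (n - T) n).image fun y => {y})
    (𝒢 := cube n \ F) (I := Finset.Ioc (n - T - (s - 1 - T)) (n - T)) (d := m - 1) ?_ ?_
  · rw [Finset.card_image_of_injective _ Finset.singleton_injective, Nat.card_Ioc,
      Nat.card_Ioc, Nat.sub_sub_self (by omega), Nat.sub_sub_self (by omega)] at key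
    have h2 := h.params.defect_lt'
    have h3 := h.card_le
    rw [← h.eq] at h2
    omega
  · intro S hS
    obtain ⟨y, hy, rfl⟩ := Finset.mem_image.1 hS
    rw [Finset.disjoint_singleton_right, Finset.mem_Ioc]
    have := Finset.mem_Ioc.1 hy
    omega
  · intro S hS Z hZ hZc
    obtain ⟨y, hy, rfl⟩ := Finset.mem_image.1 hS
    have hy := Finset.mem_Ioc.1 hy
    have hZ' : ∀ x ∈ Z, n - T - (s - 1 - T) < x ∧ x ≤ n - T := fun x hx =>
      Finset.mem_Ioc.1 (hZ hx)
    have hX' : ∀ x ∈ X, 1 ≤ x ∧ x ≤ n - T := fun x hx => Finset.mem_Icc.1 (hX hx)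
    have hyZ : y ∉ Z := fun hyZ => by have := hZ' y hyZ; omega
    rw [Finset.mem_sdiff]
    constructor
    · refine Finset.mem_powerset.2 (Finset.union_subset (fun x hx => ?_) ?_)
      · have := hZ' x hx
        exact Finset.mem_Icc.2 ⟨by omega, by omega⟩
      · exact Finset.singleton_subset_iff.2 (Finset.mem_Icc.2 ⟨by omega, by omega⟩)
    · intro hmem
      refine hXF (h.dom _ hmem X (Finset.mem_powerset.2
        (hX.trans (Finset.Icc_subset_Icc_right (by omega)))) fun t => ?_)
      rw [cnt_union (by simpa using hyZ), cnt_singleton]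
      have hm := h.one_le
      have hZt := cnt_le_card Z t
      rcases le_or_gt t (n - T - (s - 1 - T)) with ht | ht
      · rw [cnt_eq_zero fun x hx => by have := hZ' x hx; omega, if_neg (by omega)]
        exact Nat.zero_le _
      · rcases lt_or_ge t (n - T) with ht' | ht'
        · rw [if_neg (by omega)]
          have h2 := Finset.card_sdiff_add_card_inter X
            (Finset.Ioc (n - T - (s - 1 - T)) (n - T))
          have h3 : (X \ Finset.Ioc (n - T - (s - 1 - T)) (n - T)).card ≤ cnt X t := by
            refine Finset.card_le_card fun x hx => ?_
            rw [Finset.mem_sdiff, Finset.mem_Ioc] at hx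
            have := hX' x hx.1
            exact Finset.mem_filter.2 ⟨hx.1, by omega⟩
          omega
        · rw [cnt_eq_card (P := X) fun x hx => by have := hX' x hx; omega]
          split_ifs <;> omega

/-- The `k` good sets are completed by `m-1` points each from the initial segment, where `P` leaves
at least `mT` points. The other `r-k` pieces are `m`-sets cut greedily below the window; as `r-k ≥
s-1-T`, each can take at most one of the top points. -/
theorem packs (h : NearExtremal m c s T n F) {P : Finset ℕ} {k r : ℕ} (hP : P.card ≤ 2 * m)
    (hk : Packs (Good F (m * T + 2 * m) (m - 1)) k (Finset.Ioc (n - T) n \ P))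
    (hkT : k ≤ T) (hr : s - 1 ≤ r)
    (hroom : m * r ≤ (Finset.Icc 1 (n - T) \ P).card + k) :
    Packs (· ∈ F) r (Finset.Icc 1 n \ P) := by
  have hle := h.le_sub
  have hp := h.params.lt_left
  obtain ⟨d, rfl⟩ : ∃ d, m = d + 1 := ⟨m - 1, by have := h.one_le; omega⟩
  obtain ⟨e, rfl⟩ : ∃ e, r = k + e := ⟨r - k, by omega⟩
  rw [Nat.add_sub_cancel] at hk
  have hdk : d * k ≤ (d + 1) * T := Nat.mul_le_mul (by omega) hkT
  obtain ⟨R, hR, hRc⟩ := Finset.exists_subset_card_eq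
    (s := Finset.Icc 1 ((d + 1) * T + 2 * (d + 1)) \ P) (n := d * k) (by
      have h1 := Finset.le_card_sdiff P (Finset.Icc 1 ((d + 1) * T + 2 * (d + 1)))
      rw [Nat.card_Icc] at h1
      omega)
  have hRL : R ⊆ Finset.Icc 1 ((d + 1) * T + 2 * (d + 1)) := hR.trans Finset.sdiff_subset
  have hRn : R ⊆ Finset.Icc 1 (n - T) \ P := hR.trans
    (Finset.sdiff_subset_sdiff (Finset.Icc_subset_Icc_right (by omega)) subset_rfl)
  have hdis : Disjoint (Finset.Ioc (n - T) n \ P) (Finset.Icc 1 (n - T) \ P) := by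
    refine Finset.disjoint_of_subset_left Finset.sdiff_subset
      (Finset.disjoint_of_subset_right Finset.sdiff_subset ?_)
    rw [Finset.disjoint_left]
    intro x hx hx'
    rw [Finset.mem_Ioc] at hx
    rw [Finset.mem_Icc] at hx'
    omega
  have p1 := packs_good_union hk (hdis.mono_right hRn) hRL hRc.ge
  have p2 : Packs (· ∈ F) e ((Finset.Icc 1 (n - T) \ P) \ R) := by
    refine packs_greedy (a := d + 1) (H := Finset.Ioc (n - T - (s - 1 - T)) (n - T))
      (Or.inl (by omega)) (fun X hX hXc hX1 => h.mem_of_card_inter_le_one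
        (hX.trans (Finset.sdiff_subset.trans Finset.sdiff_subset)) hXc hX1) ?_ ?_
    · refine (Finset.card_le_card Finset.inter_subset_right).trans ?_
      rw [Nat.card_Ioc]
      omega
    · rw [Finset.card_sdiff_of_subset hRn, hRc]
      have : (d + 1) * (k + e) = d * k + k + (d + 1) * e := by ring
      omega
  refine (p1.union p2 ?_).mono ?_
  · exact Finset.disjoint_union_left.2 ⟨hdis.mono_right Finset.sdiff_subset,
      Finset.disjoint_sdiff⟩
  · refine Finset.union_subset (Finset.union_subset ?_ ?_) (Finset.sdiff_subset.trans ?_)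
    · refine Finset.sdiff_subset_sdiff (fun x hx => ?_) subset_rfl
      rw [Finset.mem_Ioc] at hx
      exact Finset.mem_Icc.2 ⟨by omega, hx.2⟩
    · exact hRn.trans
        (Finset.sdiff_subset_sdiff (Finset.Icc_subset_Icc_right (by omega)) subset_rfl)
    · exact Finset.sdiff_subset_sdiff (Finset.Icc_subset_Icc_right (by omega)) subset_rfl

theorem not_packs_good (h : NearExtremal m c s T n F) :
    ¬ Packs (Good F (m * T + 2 * m) (m - 1)) (T - c) (Finset.Ioc (n - T) n) := by
  intro hp
  have h1 := h.le_sub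
  have h2 := h.params.two_mul_add_three_le
  have h3 := h.eq
  refine h.not_packs ?_
  have := h.packs (P := ∅) (r := s) (by simp) (by simpa using hp) (by omega) (by omega)
    (by simp only [Finset.sdiff_empty, Nat.card_Icc]; omega)
  simpa using this

theorem good_singleton_mono (h : NearExtremal m c s T n F) {u x : ℕ} (hx : n - T < x)
    (hxu : x ≤ u) (hu : u ≤ n) (hg : Good F (m * T + 2 * m) (m - 1) {u}) :
    Good F (m * T + 2 * m) (m - 1) {x} := by
  refine h.dom.good_mono h.le_sub.1 ?_ ?_ (fun t => ?_) hg
  · exact Finset.singleton_subset_iff.2 (Finset.mem_Ioc.2 ⟨by omega, by omega⟩)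
  · exact Finset.singleton_subset_iff.2 (Finset.mem_Ioc.2 ⟨by omega, by omega⟩)
  · rw [cnt_singleton, cnt_singleton]; split_ifs <;> omega

theorem good_pair_mono (h : NearExtremal m c s T n F) {a b x y : ℕ} (hx : n - T < x)
    (hy : n - T < y) (hxy : x ≠ y) (hab : a < b) (hb : b ≤ n) (hxb : x ≤ b) (hyb : y ≤ b)
    (hor : x ≤ a ∨ y ≤ a) (hg : Good F (m * T + 2 * m) (m - 1) {a, b}) :
    Good F (m * T + 2 * m) (m - 1) {x, y} := by
  by_cases ha : n - T < a
  · refine h.dom.good_mono h.le_sub.1 ?_ ?_ (fun t => ?_) hg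
    · intro z hz
      rw [Finset.mem_insert, Finset.mem_singleton] at hz
      exact Finset.mem_Ioc.2 ⟨by omega, by omega⟩
    · intro z hz
      rw [Finset.mem_insert, Finset.mem_singleton] at hz
      exact Finset.mem_Ioc.2 ⟨by omega, by omega⟩
    · rw [cnt_pair hab.ne, cnt_pair hxy]; split_ifs <;> omega
  -- If `a` lay below the window, `hor` would put `x` or `y` there too.
  · omega

theorem packs_good_of_singleton (h : NearExtremal m c s T n F) {u : ℕ} (hu : u ≤ n)
    (hg : Good F (m * T + 2 * m) (m - 1) {u}) {Y : Finset ℕ}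
    (hY : Y ⊆ Finset.Ioc (n - T) u) :
    Packs (Good F (m * T + 2 * m) (m - 1)) Y.card Y := by
  refine packs_of_card (a := 1) (fun X hX hXc => ?_) (by omega)
  obtain ⟨x, rfl⟩ := Finset.card_eq_one.1 hXc
  have := Finset.mem_Ioc.1 (hY (Finset.singleton_subset_iff.1 hX))
  exact h.good_singleton_mono this.1 this.2 hu hg

/-- Were `P` a member, `s-1` further disjoint members could be packed around it. A good singleton in
`(n-T, u]` saves exactly one point, so the room available is that of `[u] \ P` plus `k`. -/
theorem notMem_of_packs (h : NearExtremal m c s T n F) {P : Finset ℕ} {u k : ℕ}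
    (hP : P.card ≤ 2 * m) (hu : u ≤ n) (huT : n - T ≤ u)
    (hg : Good F (m * T + 2 * m) (m - 1) {u})
    (hk : Packs (Good F (m * T + 2 * m) (m - 1)) k (Finset.Ioc u n \ P))
    (hkn : k ≤ n - u) (hroom : m * (s - 1) + (P ∩ Finset.Icc 1 u).card ≤ u + k) : P ∉ F := by
  intro hPF
  have hle := h.le_sub
  have hp := h.params.lt_left
  have p1 := h.packs_good_of_singleton hu hg
    (Finset.sdiff_subset : Finset.Ioc (n - T) u \ P ⊆ _)
  have hdis : Disjoint (Finset.Ioc (n - T) u \ P) (Finset.Ioc u n \ P) := by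
    refine Finset.disjoint_of_subset_left Finset.sdiff_subset
      (Finset.disjoint_of_subset_right Finset.sdiff_subset ?_)
    rw [Finset.disjoint_left]
    intro x hx hx'
    rw [Finset.mem_Ioc] at hx hx'
    omega
  have p2 := p1.union hk hdis
  rw [← Finset.union_sdiff_distrib, Finset.Ioc_union_Ioc_eq_Ioc huT hu] at p2
  have hc1 : (Finset.Ioc (n - T) u \ P).card ≤ u - (n - T) := by
    refine (Finset.card_le_card (Finset.sdiff_subset (s := Finset.Ioc (n - T) u) (t := P))).trans ?_
    rw [Nat.card_Ioc]
  have hc2 : (Finset.Icc 1 u \ P).card ≤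
      (Finset.Icc 1 (n - T) \ P).card + (Finset.Ioc (n - T) u \ P).card := by
    refine (Finset.card_le_card ?_).trans (Finset.card_union_le _ _)
    intro x hx
    simp only [Finset.mem_union, Finset.mem_sdiff, Finset.mem_Icc, Finset.mem_Ioc] at hx ⊢
    by_cases hxn : x ≤ n - T
    · exact Or.inl ⟨⟨hx.1.1, hxn⟩, hx.2⟩
    · exact Or.inr ⟨⟨by omega, hx.1.2⟩, hx.2⟩
  have hc3 := Finset.card_sdiff_add_card_inter (Finset.Icc 1 u) P
  rw [Nat.card_Icc, Finset.inter_comm] at hc3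
  have p3 := h.packs hP p2 (by omega) le_rfl (by omega)
  have hs : s - 1 + 1 = s := by omega
  exact h.not_packs (hs ▸ p3.insert hPF (Finset.mem_powerset.1 (h.subset hPF)))

/-- All pairs above `u = n-(2c+1)` are good. If `P` has `a` points up to `u` and `b` above, then
`2a+b ≤ 2m-1` gives `⌊(2c+1-b)/2⌋ ≥ a+c+1-m` disjoint good pairs avoiding `P`, exactly the room
needed. -/
theorem subset_Q (h : NearExtremal m c s T n F)
    (hg : Good F (m * T + 2 * m) (m - 1) {n - (2 * c + 1)})
    (hg2 : Good F (m * T + 2 * m) (m - 1) {n - 1, n}) : F ⊆ Q m s (s - c) := by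
  intro P hPF
  have hle := h.le_sub
  have hp := h.params.lt_left
  have hT := h.params.two_mul_add_three_le
  have hn := h.eq
  have hm := h.one_le
  have hPc := h.subset hPF
  rw [mem_Q (by omega), ← hn]
  refine ⟨hPc, ?_⟩
  by_contra! hw
  have hu : m * s - c - 1 = n - (2 * c + 1) := by omega
  rw [hu] at hw
  refine h.notMem_of_packs (u := n - (2 * c + 1))
    (k := (Finset.Ioc (n - (2 * c + 1)) n \ P).card / 2) (by omega) (by omega) (by omega) hg
    ?_ ?_ ?_ hPF
  · refine packs_of_card (a := 2) (fun X hX hXc => ?_) (by omega)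
    obtain ⟨x, y, hxy, rfl⟩ := Finset.card_eq_two.1 hXc
    have hx := Finset.mem_Ioc.1 (Finset.mem_sdiff.1 (hX (Finset.mem_insert_self x ({y} : Finset ℕ)))).1
    have hy := Finset.mem_Ioc.1 (Finset.mem_sdiff.1
      (hX (Finset.mem_insert_of_mem (Finset.mem_singleton_self y) : y ∈ ({x, y} : Finset ℕ)))).1
    exact h.good_pair_mono (by omega) (by omega) hxy (by omega) le_rfl (by omega) (by omega)
      (by omega) hg2
  · have := Finset.card_le_card
      (Finset.sdiff_subset : Finset.Ioc (n - (2 * c + 1)) n \ P ⊆ _)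
    rw [Nat.card_Ioc] at this
    omega
  · have h1 := Finset.card_sdiff_add_card_inter (Finset.Ioc (n - (2 * c + 1)) n) P
    rw [Nat.card_Ioc, Finset.inter_comm] at h1
    have h2 : (P ∩ Finset.Icc 1 (n - (2 * c + 1))).card +
        (P ∩ Finset.Ioc (n - (2 * c + 1)) n).card ≤ P.card := by
      rw [← Finset.card_union_of_disjoint, ← Finset.inter_union_distrib_left]
      · exact Finset.card_le_card Finset.inter_subset_left
      · rw [Finset.disjoint_left]
        intro x hx hx'
        rw [Finset.mem_inter, Finset.mem_Icc] at hx
        rw [Finset.mem_inter, Finset.mem_Ioc] at hx'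
        omega
    have h3 : m * (s - 1) + m = m * s := by
      rw [← Nat.mul_succ, Nat.succ_eq_add_one, Nat.sub_add_cancel (by omega)]
    omega

theorem subset_W (h : NearExtremal m c s T n F) (hc : c = 1)
    (hg : Good F (m * T + 2 * m) (m - 1) {n - 2}) : F ⊆ W m s (s - c) := by
  intro P hPF
  have hle := h.le_sub
  have hp := h.params.lt_left
  have hT := h.params.two_mul_add_three_le
  have hn := h.eq
  have hm := h.one_le
  have hPc := h.subset hPF
  rw [mem_W (by omega), ← hn]
  refine ⟨hPc, ?_⟩
  by_contra! hw
  have hu : m * s - 1 = n - 2 := by omega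
  rw [hu] at hw
  have h3 : m * (s - 1) + m = m * s := by
    rw [← Nat.mul_succ, Nat.succ_eq_add_one, Nat.sub_add_cancel (by omega)]
  refine h.notMem_of_packs (u := n - 2) (k := 0) ?_ (by omega) (by omega) hg
    trivial (by omega) (by omega) hPF
  have h1 : P ⊆ (P ∩ Finset.Icc 1 (n - 2)) ∪ {n - 1, n} := by
    intro x hx
    have := Finset.mem_Icc.1 (Finset.mem_powerset.1 hPc hx)
    simp only [Finset.mem_union, Finset.mem_inter, Finset.mem_Icc, Finset.mem_insert,
      Finset.mem_singleton]
    by_cases hx2 : x ≤ n - 2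
    · exact Or.inl ⟨hx, this.1, hx2⟩
    · omega
  have h2 := (Finset.card_le_card h1).trans (Finset.card_union_le _ _)
  have h4 := Finset.card_le_two (a := n - 1) (b := n)
  omega

theorem subset_Q_or_W (h : NearExtremal m c s T n F) :
    F ⊆ Q m s (s - c) ∨ (c = 1 ∧ F ⊆ W m s (s - c)) := by
  classical
  have hle := h.le_sub
  have hT := h.params.two_mul_add_three_le
  have hc1 := h.one_le'
  set 𝒢 := Good F (m * T + 2 * m) (m - 1)
  have hnp := h.not_packs_good
  have hex : ∃ x, x ≤ n ∧ (n - T < x ∧ 𝒢 {x}) := by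
    by_contra! hcon
    have := h.card_le_of_not_good (ℬ := (Finset.Ioc (n - T) n).image fun y => {y}) ?_
    · rw [Finset.card_image_of_injective _ Finset.singleton_injective, Nat.card_Ioc] at this
      omega
    · intro S hS
      obtain ⟨y, hy, rfl⟩ := Finset.mem_image.1 hS
      have hy' := Finset.mem_Ioc.1 hy
      exact ⟨Finset.singleton_subset_iff.2 hy, hcon y hy'.2 hy'.1⟩
  obtain ⟨x₀, hx₀n, hx₀⟩ := hex
  obtain ⟨u, hu⟩ : ∃ u, u = Nat.findGreatest (fun x => n - T < x ∧ 𝒢 {x}) n := ⟨_, rfl⟩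
  have hun : u ≤ n := hu ▸ Nat.findGreatest_le n
  obtain ⟨huT, hug⟩ : n - T < u ∧ 𝒢 {u} :=
    hu ▸ Nat.findGreatest_spec (P := fun x => n - T < x ∧ 𝒢 {x}) hx₀n hx₀
  have hbad : ∀ x, u < x → x ≤ n → ¬ 𝒢 {x} := by
    intro x hx hxn hgx
    have := Nat.findGreatest_is_greatest (hu ▸ hx) hxn
    exact this ⟨by omega, hgx⟩
  have hbad0 : ¬ 𝒢 ∅ := by
    intro h0
    -- A good empty set could be packed arbitrarily often.
    refine hnp (packs_of_card (a := 0) (fun X _ hXc => ?_) (by omega))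
    rw [Finset.card_eq_zero.1 hXc]; exact h0
  obtain ⟨ℬ, hℬ⟩ : ∃ ℬ : Finset (Finset ℕ),
      ℬ = insert ∅ ((Finset.Ioc u n).image fun y => {y}) := ⟨_, rfl⟩
  have hℬcard : ℬ.card = 1 + (n - u) := by
    rw [hℬ, Finset.card_insert_of_notMem (by simp),
      Finset.card_image_of_injective _ Finset.singleton_injective, Nat.card_Ioc]
    omega
  have hℬbad : ∀ S ∈ ℬ, S ⊆ Finset.Ioc (n - T) n ∧ ¬ 𝒢 S := by
    intro S hS
    rw [hℬ] at hS
    rcases Finset.mem_insert.1 hS with rfl | hS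
    · exact ⟨Finset.empty_subset _, hbad0⟩
    · obtain ⟨y, hy, rfl⟩ := Finset.mem_image.1 hS
      have hy' := Finset.mem_Ioc.1 hy
      exact ⟨Finset.singleton_subset_iff.2 (Finset.mem_Ioc.2 ⟨by omega, by omega⟩),
        hbad y hy'.1 hy'.2⟩
  have hℬone : ∀ S ∈ ℬ, S.card ≤ 1 := by
    intro S hS
    rw [hℬ] at hS
    rcases Finset.mem_insert.1 hS with rfl | hS
    · simp
    · obtain ⟨y, hy, rfl⟩ := Finset.mem_image.1 hS
      simp
  have hcount : ∀ 𝒟 : Finset (Finset ℕ), (∀ S ∈ 𝒟, S.card = 2) →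
      (∀ S ∈ 𝒟, S ⊆ Finset.Ioc (n - T) n ∧ ¬ 𝒢 S) → 1 + (n - u) + 𝒟.card ≤ 2 * c + 2 := by
    intro 𝒟 h1 h2
    have hdis : Disjoint ℬ 𝒟 := by
      rw [Finset.disjoint_left]
      intro S hS hS'
      have := hℬone S hS
      have := h1 S hS'
      omega
    rw [← hℬcard, ← Finset.card_union_of_disjoint hdis]
    refine h.card_le_of_not_good fun S hS => ?_
    rcases Finset.mem_union.1 hS with hS | hS
    · exact hℬbad S hS
    · exact h2 S hS
  have hpair_sub : ∀ {x y : ℕ}, n - T < x → n - T < y → x ≤ n → y ≤ n →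
      ({x, y} : Finset ℕ) ⊆ Finset.Ioc (n - T) n := by
    intro x y hx hy hxn hyn z hz
    rw [Finset.mem_insert, Finset.mem_singleton] at hz
    exact Finset.mem_Ioc.2 ⟨by omega, by omega⟩
  have p1 := h.packs_good_of_singleton hun hug (subset_refl (Finset.Ioc (n - T) u))
  rw [Nat.card_Ioc] at p1
  have ht1 : c < n - u := by
    by_contra! hle'
    refine hnp (packs_of_card (a := 1) (R := Finset.Ioc (n - T) u) (fun X hX hXc => ?_)
      ?_ |>.mono (Finset.Ioc_subset_Ioc_right hun))
    · obtain ⟨x, rfl⟩ := Finset.card_eq_one.1 hXc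
      have := Finset.mem_Ioc.1 (Finset.singleton_subset_iff.1 hX)
      exact h.good_singleton_mono this.1 this.2 hun hug
    · rw [Nat.card_Ioc]; omega
  have ht2 : n - u ≤ 2 * c + 1 := by
    have := hcount ∅ (by simp) (by simp)
    simp at this
    omega
  rcases Nat.eq_or_lt_of_le ht2 with ht | ht
  · left
    refine h.subset_Q ?_ ?_
    · rwa [show n - (2 * c + 1) = u by omega]
    · by_contra hnot
      have := hcount {{n - 1, n}} ?_ ?_
      · rw [Finset.card_singleton] at this
        omega
      · intro S hS
        rw [Finset.mem_singleton.1 hS]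
        exact Finset.card_pair (by omega)
      · intro S hS
        rw [Finset.mem_singleton.1 hS]
        exact ⟨hpair_sub (by omega) (by omega) (by omega) le_rfl, hnot⟩
  -- Here `1 ≤ q ≤ c`, so the `q` nested pairs on `u+1, …, u+2q` stay within `[n]`; with the `T-c-q`
  -- good singletons they would make `T-c` good sets.
  obtain ⟨q, hq⟩ : ∃ q, n - u = c + q := ⟨n - u - c, by omega⟩
  by_cases hall : ∀ i < q, 𝒢 {u + (i + 1), u + (2 * q - i)}
  · exfalso
    have p2 : Packs 𝒢 q (Finset.Ioc u n) := by
      refine packs_of_indexed (fun i => {u + (i + 1), u + (2 * q - i)}) hall ?_ ?_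
      · intro i hi z hz
        rw [Finset.mem_insert, Finset.mem_singleton] at hz
        exact Finset.mem_Ioc.2 ⟨by omega, by omega⟩
      · intro i hi j hj hij
        rw [Finset.disjoint_left]
        intro z hz hz'
        rw [Finset.mem_insert, Finset.mem_singleton] at hz hz'
        omega
    have p3 := p1.union p2 (by
      rw [Finset.disjoint_left]
      intro x hx hx'
      rw [Finset.mem_Ioc] at hx hx'
      omega)
    rw [Finset.Ioc_union_Ioc_eq_Ioc huT.le hun, show u - (n - T) + q = T - c by omega] at p3
    exact hnp p3
  · push Not at hall
    obtain ⟨i, hi, hgi⟩ := hall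
    -- Raising the larger point of a bad pair keeps it bad. These `c-q+i+1` pairs bring the bad
    -- total to `2c+2+i`, which forces `i = 0` and leaves no slack.
    obtain ⟨𝒟, h𝒟⟩ : ∃ 𝒟 : Finset (Finset ℕ), 𝒟 =
        (Finset.Icc (2 * q - i) (n - u)).image fun j => {u + (i + 1), u + j} := ⟨_, rfl⟩
    have h𝒟c : 𝒟.card = n - u + 1 - (2 * q - i) := by
      rw [h𝒟, Finset.card_image_of_injOn, Nat.card_Icc]
      intro j hj j' hj' heq
      rw [Finset.mem_coe, Finset.mem_Icc] at hj hj'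
      have h1 : u + j ∈ ({u + (i + 1), u + j'} : Finset ℕ) := by
        dsimp only at heq
        rw [← heq]; simp
      rw [Finset.mem_insert, Finset.mem_singleton] at h1
      omega
    have h𝒟two : ∀ S ∈ 𝒟, S.card = 2 := by
      intro S hS
      rw [h𝒟] at hS
      obtain ⟨j, hj, rfl⟩ := Finset.mem_image.1 hS
      rw [Finset.mem_Icc] at hj
      exact Finset.card_pair (by omega)
    have h𝒟bad : ∀ S ∈ 𝒟, S ⊆ Finset.Ioc (n - T) n ∧ ¬ 𝒢 S := by
      intro S hS
      rw [h𝒟] at hS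
      obtain ⟨j, hj, rfl⟩ := Finset.mem_image.1 hS
      rw [Finset.mem_Icc] at hj
      refine ⟨hpair_sub (by omega) (by omega) (by omega) (by omega), fun hgj => hgi ?_⟩
      exact h.good_pair_mono (by omega) (by omega) (by omega) (by omega) (by omega) (by omega)
        (by omega) (Or.inl le_rfl) hgj
    have h1 := hcount 𝒟 h𝒟two h𝒟bad
    have hi0 : i = 0 := by omega
    subst hi0
    by_cases ht3 : 3 ≤ n - u
    · exfalso
      -- One more bad pair, avoiding `u+1`, breaks the budget.
      have hnew : ({u + 2, u + (n - u)} : Finset ℕ) ∉ 𝒟 := by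
        rw [h𝒟]
        intro hS
        obtain ⟨j, hj, heq⟩ := Finset.mem_image.1 hS
        have : u + (0 + 1) ∈ ({u + 2, u + (n - u)} : Finset ℕ) := by rw [← heq]; simp
        rw [Finset.mem_insert, Finset.mem_singleton] at this
        omega
      have h2 := hcount (insert {u + 2, u + (n - u)} 𝒟) ?_ ?_
      · rw [Finset.card_insert_of_notMem hnew] at h2
        omega
      · intro S hS
        rcases Finset.mem_insert.1 hS with rfl | hS
        · exact Finset.card_pair (by omega)
        · exact h𝒟two S hS
      · intro S hS
        rcases Finset.mem_insert.1 hS with rfl | hS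
        · refine ⟨hpair_sub (by omega) (by omega) (by omega) (by omega), fun hgj => hgi ?_⟩
          exact h.good_pair_mono (by omega) (by omega) (by omega) (by omega) (by omega)
            (by omega) (by omega) (Or.inl (by omega)) hgj
        · exact h𝒟bad S hS
    · right
      have hc : c = 1 := by omega
      refine ⟨hc, h.subset_W hc ?_⟩
      rwa [show n - 2 = u by omega]

end NearExtremal

/-! ### The two extremal families have the same size for `c = 1` -/

theorem cnt_succ (P : Finset ℕ) (t : ℕ) :
    cnt P (t + 1) = cnt P t + if t + 1 ∈ P then 1 else 0 := by
  have h : P.filter (· ≤ t + 1) = P.filter (· ≤ t) ∪ P.filter (· = t + 1) := by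
    ext x
    simp only [Finset.mem_filter, Finset.mem_union]
    by_cases hx : x ∈ P
    · simp only [hx, true_and]; omega
    · simp [hx]
  rw [cnt, h, Finset.card_union_of_disjoint, Finset.filter_eq']
  · rw [cnt]; split_ifs <;> rfl
  · rw [Finset.disjoint_filter]; intro x _ h1 h2; omega

theorem cnt_symmDiff_Icc (P : Finset ℕ) (N b : ℕ) :
    cnt (symmDiff P (Finset.Icc (N + 1) b)) N = cnt P N := by
  rw [cnt, cnt]
  congr 1
  ext x
  simp only [Finset.mem_filter, Finset.mem_symmDiff, Finset.mem_Icc]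
  constructor
  · rintro ⟨h1 | h1, h2⟩
    · exact ⟨h1.1, h2⟩
    · omega
  · rintro ⟨h1, h2⟩
    exact ⟨Or.inl ⟨h1, by omega⟩, h2⟩

/-- Sets in exactly one family have `m-1` points in `[N]`. Their trace on the top three points is
`{N+2, N+3}` for `Q` only and `{N+1}` for `W` only, and these are complementary. -/
theorem symmDiff_mem_sdiff {m s N : ℕ} (hs : 1 < s) (hN : m * s = N + 2) {P : Finset ℕ} :
    (P ∈ Q m s (s - 1) \ W m s (s - 1) →
      symmDiff P (Finset.Icc (N + 1) (N + 3)) ∈ W m s (s - 1) \ Q m s (s - 1)) ∧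
    (P ∈ W m s (s - 1) \ Q m s (s - 1) →
      symmDiff P (Finset.Icc (N + 1) (N + 3)) ∈ Q m s (s - 1) \ W m s (s - 1)) := by
  rw [Finset.mem_sdiff, Finset.mem_sdiff, Finset.mem_sdiff, Finset.mem_sdiff,
    mem_Q hs.le, mem_W hs.le, mem_W hs.le, mem_Q hs.le, hN,
    show N + 2 - 1 - 1 = N by omega, show N + 2 - 1 = N + 1 by omega]
  by_cases hP : P ∈ cube (N + 2 + 1)
  · set R := symmDiff P (Finset.Icc (N + 1) (N + 3)) with hR
    have hRc : R ∈ cube (N + 2 + 1) := by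
      refine Finset.mem_powerset.2 fun x hx => ?_
      rw [hR, Finset.mem_symmDiff] at hx
      rcases hx with hx | hx
      · exact Finset.mem_powerset.1 hP hx.1
      · have := Finset.mem_Icc.1 hx.1
        exact Finset.mem_Icc.2 ⟨by omega, by omega⟩
    have h0 : cnt R N = cnt P N := cnt_symmDiff_Icc P N _
    have hmem : ∀ x, N + 1 ≤ x → x ≤ N + 3 → (x ∈ R ↔ x ∉ P) := by
      intro x h1 h2
      rw [hR, Finset.mem_symmDiff, Finset.mem_Icc]
      tauto
    have e1 := hmem (N + 1) (by omega) (by omega)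
    have e2 := hmem (N + 1 + 1) (by omega) (by omega)
    have e3 := hmem (N + 2 + 1) (by omega) (by omega)
    rw [← cnt_eq_card_inter hP, ← cnt_eq_card_inter hP, ← cnt_eq_card_inter hRc,
      ← cnt_eq_card_inter hRc, card_eq_cnt hP, card_eq_cnt hRc]
    simp only [cnt_succ, h0, e1, e2, e3, hP, hRc, true_and]
    constructor
    · split_ifs <;> omega
    · split_ifs <;> omega
  · constructor
    · intro h; exact absurd h.1.1 hP
    · intro h; exact absurd h.1.1 hP

theorem card_W_eq_card_Q {m s : ℕ} (hm : 1 ≤ m) (hs : 1 < s) :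
    (W m s (s - 1)).card = (Q m s (s - 1)).card := by
  have hms : s ≤ m * s := Nat.le_mul_of_pos_left s hm
  obtain ⟨N, hN⟩ : ∃ N, m * s = N + 2 := ⟨m * s - 2, by omega⟩
  have hinj : Function.Injective fun P : Finset ℕ => symmDiff P (Finset.Icc (N + 1) (N + 3)) :=
    symmDiff_left_injective _
  have h1 := Finset.card_le_card_of_injOn (s := Q m s (s - 1) \ W m s (s - 1))
    (t := W m s (s - 1) \ Q m s (s - 1)) _
    (fun P hP => (symmDiff_mem_sdiff hs hN).1 hP) hinj.injOn
  have h2 := Finset.card_le_card_of_injOn (s := W m s (s - 1) \ Q m s (s - 1))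
    (t := Q m s (s - 1) \ W m s (s - 1)) _
    (fun P hP => (symmDiff_mem_sdiff hs hN).2 hP) hinj.injOn
  have h3 := Finset.card_sdiff_add_card_inter (Q m s (s - 1)) (W m s (s - 1))
  have h4 := Finset.card_sdiff_add_card_inter (W m s (s - 1)) (Q m s (s - 1))
  rw [Finset.inter_comm] at h4
  omega

/-! ### Extremal families -/

theorem Q_subset_cube {m s c : ℕ} (hcs : c ≤ s) : Q m s (s - c) ⊆ cube (m * s + c) :=
  fun _ hP => ((mem_Q hcs).1 hP).1

theorem W_subset_cube {m s c : ℕ} (hcs : c ≤ s) : W m s (s - c) ⊆ cube (m * s + c) :=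
  fun _ hP => ((mem_W hcs).1 hP).1

section

variable {m c s T : ℕ} {F : Finset (Finset ℕ)}

/-- The structure theorem is applied to the up-closure; cardinality then squeezes `F` itself onto
`Q` or `W`. -/
theorem eq_Q_or_W (hm : 1 ≤ m) (hc : 1 ≤ c) (hp : Params m c s T)
    (hF : F ⊆ cube (m * s + c)) (h0 : ∅ ∉ F) (hν : matchingNumber F < s) (hst : StepClosed F)
    (hcard : (Q m s (s - c)).card ≤ F.card) :
    F = Q m s (s - c) ∨ (c = 1 ∧ F = W m s (s - c)) := by
  have hcs : c < s := by have := hp.lt_left; omega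
  have hsub := subset_upClosure hF
  have hupc : upClosure (m * s + c) F ⊆ cube (m * s + c) := Finset.filter_subset _ _
  have hle := Finset.card_le_card hsub
  have hne : NearExtremal m c s T (m * s + c) (upClosure (m * s + c) F) :=
    { one_le := hm
      one_le' := hc
      params := hp
      eq := rfl
      subset := hupc
      dom := hst.domClosed_upClosure
      not_packs := not_packs_upClosure h0 hν _
      card_le := by
        refine le_trans ?_ (card_compl_Q_le hm hcs)
        rw [Finset.card_sdiff_of_subset hupc, Finset.card_sdiff_of_subset (Q_subset_cube hcs.le)]
        omega }
  rcases hne.subset_Q_or_W with h | ⟨rfl, h⟩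
  · exact Or.inl (Finset.eq_of_subset_of_card_le (hsub.trans h) hcard)
  · refine Or.inr ⟨rfl, Finset.eq_of_subset_of_card_le (hsub.trans h) ?_⟩
    rw [card_W_eq_card_Q hm hcs]
    exact hcard

theorem card_le_card_Q_of_empty_notMem (hm : 1 ≤ m) (hc : 1 ≤ c) (hp : Params m c s T)
    (hF : F ⊆ cube (m * s + c)) (h0 : ∅ ∉ F) (hν : matchingNumber F < s) :
    F.card ≤ (Q m s (s - c)).card := by
  have hcs : c < s := by have := hp.lt_left; omega
  by_contra! hlt
  obtain ⟨G, hG, hG0, hGν, hGc, hGs⟩ := exists_stepClosed (by omega) hF h0 hν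
  rcases eq_Q_or_W hm hc hp hG hG0 hGν hGs (by omega) with h | ⟨rfl, h⟩
  · rw [h] at hGc; omega
  · rw [h, card_W_eq_card_Q hm hcs] at hGc; omega

/-- Two intersecting sets may replace the empty set. -/
theorem matchingNumber_insert_insert_lt (h0 : ∅ ∈ F) (hs : 0 < s) (hν : matchingNumber F < s)
    {P R : Finset ℕ} (hPR : P ≠ R) (hint : ¬ Disjoint P R) :
    matchingNumber (insert P (insert R (F.erase ∅))) < s := by
  rw [matchingNumber_lt_iff hs] at hν ⊢
  intro M hM hMm
  have hsub : insert ∅ (M \ {P, R}) ⊆ F := by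
    refine Finset.insert_subset h0 fun A hA => ?_
    obtain ⟨h1, h2⟩ := Finset.mem_sdiff.1 hA
    have h3 := hM h1
    simp only [Finset.mem_insert, Finset.mem_singleton, Finset.mem_erase] at h2 h3
    tauto
  have hmat : IsMatching (insert ∅ (M \ {P, R})) := by
    intro A hA B hB hne
    rcases Finset.mem_insert.1 hA with h | hA
    · rw [h]; exact Finset.disjoint_empty_left _
    rcases Finset.mem_insert.1 hB with h | hB
    · rw [h]; exact Finset.disjoint_empty_right _
    · exact hMm A (Finset.mem_sdiff.1 hA).1 B (Finset.mem_sdiff.1 hB).1 hne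
  have hnot : ∅ ∉ M \ {P, R} := by
    intro hA
    obtain ⟨h1, h2⟩ := Finset.mem_sdiff.1 hA
    have h3 := hM h1
    simp only [Finset.mem_insert, Finset.mem_singleton, Finset.mem_erase] at h2 h3
    tauto
  have hone : (M ∩ {P, R}).card ≤ 1 := by
    rw [Finset.card_le_one]
    intro A hA B hB
    by_contra hne
    obtain ⟨hA1, hA2⟩ := Finset.mem_inter.1 hA
    obtain ⟨hB1, hB2⟩ := Finset.mem_inter.1 hB
    have hd := hMm A hA1 B hB1 hne
    rw [Finset.mem_insert, Finset.mem_singleton] at hA2 hB2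
    rcases hA2 with rfl | rfl <;> rcases hB2 with rfl | rfl
    · exact hne rfl
    · exact hint hd
    · exact hint hd.symm
    · exact hne rfl
  have h1 := hν _ hsub hmat
  rw [Finset.card_insert_of_notMem hnot] at h1
  have h2 := Finset.card_sdiff_add_card_inter M {P, R}
  omega

/-- Otherwise the exchange forces distinct missing sets to be disjoint. If `J` collects the points
whose singletons are missing, every pair inside `J` is a member, so the other singletons, pairs in
`J` and the empty set form a large matching. -/
theorem card_lt_card_Q_of_empty_mem (hm : 1 ≤ m) (hc : 1 ≤ c) (hp : Params m c s T)
    (hF : F ⊆ cube (m * s + c)) (h0 : ∅ ∈ F) (hν : matchingNumber F < s) :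
    F.card < (Q m s (s - c)).card := by
  have hcs : c < s := by have := hp.lt_left; omega
  by_contra! hle
  have hkey : ∀ P ∈ cube (m * s + c), ∀ R ∈ cube (m * s + c), P ∉ F → P ≠ R →
      ¬ Disjoint P R → R ∈ F := by
    intro P hP R hR hPF hPR hint
    by_contra hRF
    have hP0 : ∅ ≠ P := fun h => hPF (h ▸ h0)
    have hR0 : ∅ ≠ R := fun h => hRF (h ▸ h0)
    have h1 := card_le_card_Q_of_empty_notMem hm hc hp
      (F := insert P (insert R (F.erase ∅)))
      (Finset.insert_subset hP (Finset.insert_subset hR ((Finset.erase_subset _ _).trans hF)))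
      (by simp [hP0, hR0]) (matchingNumber_insert_insert_lt h0 (by omega) hν hPR hint)
    rw [Finset.card_insert_of_notMem (by simp [hPR, hPF]),
      Finset.card_insert_of_notMem (by simp [hRF]), Finset.card_erase_add_one h0] at h1
    omega
  have hsing : ∀ x ∈ Finset.Icc 1 (m * s + c), {x} ∈ cube (m * s + c) := fun x hx =>
    Finset.mem_powerset.2 (Finset.singleton_subset_iff.2 hx)
  obtain ⟨J, hJ⟩ : ∃ J, J = (Finset.Icc 1 (m * s + c)).filter fun x => {x} ∉ F := ⟨_, rfl⟩
  have hJsub : J ⊆ Finset.Icc 1 (m * s + c) := hJ ▸ Finset.filter_subset _ _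
  have hJmem : ∀ x ∈ J, {x} ∉ F := by
    intro x hx
    rw [hJ] at hx
    exact (Finset.mem_filter.1 hx).2
  have hJcard := Finset.card_le_card hJsub
  have p1 : Packs (· ∈ F.erase ∅) (Finset.Icc 1 (m * s + c) \ J).card
      (Finset.Icc 1 (m * s + c) \ J) := by
    refine packs_of_card (a := 1) (fun X hX hXc => ?_) (by omega)
    obtain ⟨x, rfl⟩ := Finset.card_eq_one.1 hXc
    have hx := Finset.mem_sdiff.1 (Finset.singleton_subset_iff.1 hX)
    refine Finset.mem_erase.2 ⟨Finset.singleton_ne_empty x, ?_⟩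
    by_contra hxF
    exact hx.2 (hJ ▸ Finset.mem_filter.2 ⟨hx.1, hxF⟩)
  have p2 : Packs (· ∈ F.erase ∅) (J.card / 2) J := by
    refine packs_of_card (a := 2) (fun X hX hXc => ?_) (by omega)
    obtain ⟨x, y, hxy, rfl⟩ := Finset.card_eq_two.1 hXc
    have hx : x ∈ J := hX (Finset.mem_insert_self x {y})
    have hxF : {x} ∉ F := hJmem x hx
    refine Finset.mem_erase.2 ⟨Finset.insert_ne_empty x {y},
      hkey {x} (hsing x (hJsub hx)) _ (Finset.mem_powerset.2 (hX.trans hJsub)) hxF ?_ ?_⟩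
    · intro h
      have : y ∈ ({x} : Finset ℕ) := by rw [h]; simp
      exact hxy (Finset.mem_singleton.1 this).symm
    · simp
  have p3 := p1.union p2 Finset.sdiff_disjoint
  obtain ⟨M, hM1, hM2, hM3⟩ := p3.exists_matching (by simp)
  have hlt := (matchingNumber_lt_iff (by omega)).1 hν (insert ∅ M) ?_ ?_
  · rw [Finset.card_insert_of_notMem (fun h => by simpa using (hM1 _ h).1), hM3,
      Finset.card_sdiff_of_subset hJsub] at hlt
    rw [Nat.card_Icc] at hlt hJcard
    -- For `m = 1` at most `2c+2` sets are missing, so the matching has at least `(s+c)-(c+1)+1 = s`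
    -- members. For `m ≥ 2` already half of the `n ≥ 2s` points suffice.
    rcases Nat.eq_or_lt_of_le hm with rfl | hm2
    · have h1 : J.card ≤ (cube (1 * s + c) \ F).card := by
        rw [← Finset.card_image_of_injective J Finset.singleton_injective]
        refine Finset.card_le_card fun X hX => ?_
        obtain ⟨x, hx, rfl⟩ := Finset.mem_image.1 hX
        exact Finset.mem_sdiff.2 ⟨hsing x (hJsub hx), hJmem x hx⟩
      have h2 := card_compl_Q_le le_rfl hcs
      rw [Finset.card_sdiff_of_subset (Q_subset_cube hcs.le)] at h2
      rw [Finset.card_sdiff_of_subset hF] at h1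
      simp only [defect, lowSum, Nat.sub_self, Nat.choose_zero_right, Finset.range_zero,
        Finset.sum_empty] at h2
      omega
    · have h1 : 2 * s ≤ m * s := Nat.mul_le_mul_right s hm2
      omega
  · exact Finset.insert_subset h0 fun A hA => Finset.mem_of_mem_erase (hM1 A hA).1
  · intro A hA B hB hne
    rcases Finset.mem_insert.1 hA with h | hA
    · rw [h]; exact Finset.disjoint_empty_left _
    rcases Finset.mem_insert.1 hB with h | hB
    · rw [h]; exact Finset.disjoint_empty_right _
    · exact hM2 A hA B hB hne

theorem e_eq_card_Q (hm : 1 ≤ m) (hc : 1 ≤ c) (hp : Params m c s T) :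
    e (m * s + c) s = (Q m s (s - c)).card := by
  have hcs : c < s := by have := hp.lt_left; omega
  refine le_antisymm (Finset.sup_le fun F hF => ?_) ?_
  · rw [Finset.mem_filter, Finset.mem_powerset] at hF
    by_cases h0 : ∅ ∈ F
    · exact (card_lt_card_Q_of_empty_mem hm hc hp hF.1 h0 hF.2).le
    · exact card_le_card_Q_of_empty_notMem hm hc hp hF.1 h0 hF.2
  · exact Finset.le_sup (f := Finset.card) (Finset.mem_filter.2
      ⟨Finset.mem_powerset.2 (Q_subset_cube hcs.le), matchingNumber_Q_lt hm hcs⟩)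

theorem IsShiftedExtremal.eq_Q_or_W (hm : 1 ≤ m) (hc : 1 ≤ c) (hp : Params m c s T)
    (h : IsShiftedExtremal (m * s + c) s F) :
    F = Q m s (s - c) ∨ (c = 1 ∧ F = W m s (s - c)) := by
  obtain ⟨hF, hν, hcard, hsh⟩ := h
  rw [e_eq_card_Q hm hc hp] at hcard
  have h0 : ∅ ∉ F := fun h0 => by
    have := card_lt_card_Q_of_empty_mem hm hc hp hF h0 hν
    omega
  exact MatchingFree.eq_Q_or_W hm hc hp hF h0 hν (hsh.stepClosed hF) hcard.ge

theorem isShiftedExtremal_Q (hm : 1 ≤ m) (hc : 1 ≤ c) (hp : Params m c s T) :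
    IsShiftedExtremal (m * s + c) s (Q m s (s - c)) := by
  have hcs : c < s := by have := hp.lt_left; omega
  exact ⟨Q_subset_cube hcs.le, matchingNumber_Q_lt hm hcs, (e_eq_card_Q hm hc hp).symm,
    (domClosed_Q hcs.le).isShifted⟩

theorem isShiftedExtremal_W (hm : 1 ≤ m) (hp : Params m 1 s T) :
    IsShiftedExtremal (m * s + 1) s (W m s (s - 1)) := by
  have hcs : 1 < s := by have := hp.lt_left; omega
  exact ⟨W_subset_cube hcs.le, matchingNumber_W_lt hm hcs,
    (card_W_eq_card_Q hm hcs).trans (e_eq_card_Q hm le_rfl hp).symm,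
    (domClosed_W hcs.le).isShifted⟩

end

end MatchingFree

theorem theoremt (m c : ℕ) (hm : 1 ≤ m) (hc : 1 ≤ c) :
    ∃ s₀ : ℕ, c < s₀ ∧ ∀ s : ℕ, s₀ ≤ s → ∀ n ℓ : ℕ, n = m * s + c → ℓ = s - c →
      MatchingFree.e n s = (MatchingFree.Q m s ℓ).card ∧
      (2 ≤ c → ∀ F : Finset (Finset ℕ),
        MatchingFree.IsShiftedExtremal n s F ↔ F = MatchingFree.Q m s ℓ) ∧
      (c = 1 → ∀ F : Finset (Finset ℕ),
        MatchingFree.IsShiftedExtremal n s F ↔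
          F = MatchingFree.Q m s ℓ ∨ F = MatchingFree.W m s ℓ) := by
  obtain ⟨T, s₀, hs₀⟩ := MatchingFree.exists_params (c := c) hm
  refine ⟨max s₀ (c + 1), by omega, ?_⟩
  rintro s hs n ℓ rfl rfl
  have hp := hs₀ s (by omega)
  refine ⟨MatchingFree.e_eq_card_Q hm hc hp, fun hc2 F => ⟨fun h => ?_, ?_⟩,
    fun hc1 F => ⟨fun h => ?_, ?_⟩⟩
  · rcases h.eq_Q_or_W hm hc hp with h | h
    · exact h
    · omega
  · rintro rfl
    exact MatchingFree.isShiftedExtremal_Q hm hc hp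
  · exact (h.eq_Q_or_W hm hc hp).imp_right And.right
  · subst hc1
    rintro (rfl | rfl)
    · exact MatchingFree.isShiftedExtremal_Q hm hc hp
    · exact MatchingFree.isShiftedExtremal_W hm hp
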